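/- (a) Let $d\ge 1$, let $B\subset\mathbb{E}^d$ be a closed ball of radius $r>0$ centered at the origin, and let $\mu:B\to[0,\infty)$ be rotationally symmetric (i.e. $\mu(p)$ depends only on $\|p\|$) and strictly decreasing (i.e. $\mu(q)<\mu(p)$ whenever $\|p\|<\|q\|$). Then $\mu$ is integrable on $B$. Let $S_{reg}$ be a regular $d$-dimensional simplex inscribed in $B$ (all its vertices lie on the boundary of $B$). Then, for every $d$-dimensional simplex $S\subset B$, $$\int_S \mu(p)\,dp\le\int_{S_{reg}}\mu(p)\,dp ,$$ with equality if and only if $S$ is a regular simplex inscribed in $B$. (b) Let $d\ge 2$ and let $C=\{y\in\mathbb{S}^{d-1} : \langle x,y\rangle\ge\cos\alpha\}$ be the closed spherical cap of angular radius $0<\alpha<\frac{\pi}{2}$ centered at $x\in\mathbb{S}^{d-1}$, where $\mathbb{S}^{d-1}$ is the unit sphere of $\mathbb{E}^d$. A spherical simplex is the intersection of $\mathbb{S}^{d-1}$ with the convex cone generated by $d$ linearly independent unit vectors, its vertices; it is regular if every permutation of its vertices is induced by an isometry of $\mathbb{S}^{d-1}$ (equivalently, if all its edges have the same length), and it is inscribed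 in $C$ if $\langle x,v\rangle=\cos\alpha$ for each of its vertices $v$. Then there are regular spherical simplices inscribed in $C$; each of them is contained in $C$ and has maximum $(d-1)$-dimensional spherical volume among all spherical simplices contained in $C$; and every spherical simplex contained in $C$ that has this maximum volume is regular and inscribed in $C$. -/

import Mathlib

open MeasureTheory

/-- `μ` is nonnegative, rotationally symmetric and radially strictly decreasing on the closed ball
of radius `r` centred at the origin. Only the values of `μ` on that ball matter. -/
structure IsRadialStrictAntiWeight {d : ℕ} (r : ℝ) (μ : EuclideanSpace ℝ (Fin d) → ℝ) : Prop where
  nonneg : ∀ p ∈ Metric.closedBall (0 : EuclideanSpace ℝ (Fin d)) r, 0 ≤ μ p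
  rotation_invariant : ∀ p ∈ Metric.closedBall (0 : EuclideanSpace ℝ (Fin d)) r,
    ∀ q ∈ Metric.closedBall (0 : EuclideanSpace ℝ (Fin d)) r, ‖p‖ = ‖q‖ → μ p = μ q
  strictAnti : ∀ p ∈ Metric.closedBall (0 : EuclideanSpace ℝ (Fin d)) r,
    ∀ q ∈ Metric.closedBall (0 : EuclideanSpace ℝ (Fin d)) r, ‖p‖ < ‖q‖ → μ q < μ p

/-- A full-dimensional simplex of `𝔼ᵈ` that is regular and inscribed in the closed ball of radius
`r` centred at the origin: all of its vertices lie on the boundary of the ball. -/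
def IsRegularInscribedInBall {d : ℕ} (r : ℝ)
    (S : Affine.Simplex ℝ (EuclideanSpace ℝ (Fin d)) d) : Prop :=
  S.Regular ∧ ∀ i, S.points i ∈ Metric.sphere (0 : EuclideanSpace ℝ (Fin d)) r

/-- The unit sphere `𝕊ᵈ⁻¹` of `𝔼ᵈ`. -/
abbrev UnitSphere (d : ℕ) : Type := Metric.sphere (0 : EuclideanSpace ℝ (Fin d)) 1

/-- A (nondegenerate, `(d-1)`-dimensional) spherical simplex in `𝕊ᵈ⁻¹`, given by its `d` linearly
independent vertices. -/
structure SphericalSimplex (d : ℕ) where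
  vertex : Fin d → UnitSphere d
  linearIndependent : LinearIndependent ℝ (fun i => (vertex i : EuclideanSpace ℝ (Fin d)))

namespace SphericalSimplex

/-- The point set of a spherical simplex: the spherical convex hull of the vertices, that is, the
intersection of the sphere with the convex cone that the vertices generate. -/
def toSet {d : ℕ} (S : SphericalSimplex d) : Set (UnitSphere d) :=
  {x | ∃ c : Fin d → ℝ, (∀ i, 0 ≤ c i) ∧
    (x : EuclideanSpace ℝ (Fin d)) = ∑ i, c i • (S.vertex i : EuclideanSpace ℝ (Fin d))}

/-- The `(d-1)`-dimensional spherical volume (surface measure on `𝕊ᵈ⁻¹`). -/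
noncomputable def vol {d : ℕ} (S : SphericalSimplex d) : ENNReal :=
  (volume : Measure (EuclideanSpace ℝ (Fin d))).toSphere S.toSet

/-- A spherical simplex is regular if every permutation of its vertices is induced by an isometry of
the sphere, that is, by a linear isometry of `𝔼ᵈ` (compare `Affine.Simplex.Regular`). -/
def Regular {d : ℕ} (S : SphericalSimplex d) : Prop :=
  ∀ σ : Equiv.Perm (Fin d),
    ∃ g : EuclideanSpace ℝ (Fin d) ≃ₗᵢ[ℝ] EuclideanSpace ℝ (Fin d),
      ∀ i, g (S.vertex i : EuclideanSpace ℝ (Fin d)) = S.vertex (σ i)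

end SphericalSimplex

/-- The closed spherical cap of `𝕊ᵈ⁻¹` with centre `x` and angular radius `α`. -/
def sphericalCap {d : ℕ} (x : UnitSphere d) (α : ℝ) : Set (UnitSphere d) :=
  {y | Real.cos α ≤ inner ℝ (x : EuclideanSpace ℝ (Fin d)) (y : EuclideanSpace ℝ (Fin d))}

/-- A spherical simplex that is regular and inscribed in the cap with centre `x` and angular radius
`α`: all of its vertices lie on the boundary of the cap, at spherical distance `α` from `x`. -/
def SphericalSimplex.IsRegularInscribedInCap {d : ℕ} (x : UnitSphere d) (α : ℝ)
    (S : SphericalSimplex d) : Prop :=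
  S.Regular ∧ ∀ i, inner ℝ (x : EuclideanSpace ℝ (Fin d))
    (S.vertex i : EuclideanSpace ℝ (Fin d)) = Real.cos α

/-! ### Regular frames and Gram matrices. -/

section InnerProductGeometry

open Set Module
open scoped RealInnerProductSpace

variable {V : Type*} [NormedAddCommGroup V] [InnerProductSpace ℝ V] {ι : Type*}

/-! Both statements are one extremal theorem for a radially decreasing density `w ‖p‖` on a
Euclidean space `V`: among simplices in a ball, the regular inscribed ones, and only those, have the
greatest measure (`radialMeasure_convexHull_le_and_eq_iff`).

A maximiser exists by compactness and upper semicontinuity, and it is nondegenerate. Take two of its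
vertices `v i`, `v j` and apply Steiner symmetrization in the hyperplane through the origin
orthogonal to `v i - v j`. Chords of a simplex parallel to an edge have their midpoints on a
hyperplane, so the symmetral is the image of the simplex under an affine shear, hence again a
simplex, and it stays in the ball. Each chord is moved to be centred nearest the origin, so the
measure grows strictly unless the simplex was already symmetric
(`exists_radialMeasure_lt_of_not_symmetric`).

A maximiser is therefore symmetric under every exchange of two vertices: the vertices have equal
norms and equal mutual inner products. Their sum is then `0`, so the simplex contains the origin and
could be enlarged if it were not inscribed (`isRegularFrame_of_isMaxOn`). Regular inscribed
simplices share a Gram matrix, so all are congruent and all are maximal; equality makes a simplex a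
maximiser, hence regular and inscribed.

Part (a) is the case where `w` is the profile of `μ`. For (b), central projection from the origin to
the hyperplane tangent at `x` turns the cap into a ball of radius `tan α`, spherical simplices into
Euclidean ones, and spherical volume into a strictly decreasing radial density
(`volume_cone_eq_radialMeasure`). -/

/-- The vectors `v i` lie on the sphere of radius `r` about the origin, and the inner products of
distinct ones all agree. -/
def IsRegularFrame (r : ℝ) (v : ι → V) : Prop :=
  (∀ i, ‖v i‖ = r) ∧ ∃ c : ℝ, ∀ i j, i ≠ j → ⟪v i, v j⟫ = c

theorem norm_sum_smul_eq_of_inner_eq [Fintype ι] {W : Type*} [NormedAddCommGroup W]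
    [InnerProductSpace ℝ W] {v : ι → V} {w : ι → W}
    (h : ∀ i j, ⟪v i, v j⟫ = ⟪w i, w j⟫) (c : ι → ℝ) :
    ‖∑ i, c i • v i‖ = ‖∑ i, c i • w i‖ := by
  rw [← sq_eq_sq₀ (norm_nonneg _) (norm_nonneg _), ← real_inner_self_eq_norm_sq,
    ← real_inner_self_eq_norm_sq]
  simp only [sum_inner, inner_sum, real_inner_smul_left, real_inner_smul_right, h]

/-- Families with the same Gram matrix, one of which spans, differ by a linear isometry. -/
theorem exists_linearIsometryEquiv_of_inner_eq [FiniteDimensional ℝ V] [Fintype ι] {v w : ι → V}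
    (hv : Submodule.span ℝ (range v) = ⊤) (h : ∀ i j, ⟪v i, v j⟫ = ⟪w i, w j⟫) :
    ∃ g : V ≃ₗᵢ[ℝ] V, ∀ i, g (v i) = w i := by
  classical
  set L := Fintype.linearCombination ℝ v
  set M := Fintype.linearCombination ℝ w
  have hnorm : ∀ c, ‖L c‖ = ‖M c‖ := fun c => by
    simpa [L, M, Fintype.linearCombination_apply] using norm_sum_smul_eq_of_inner_eq h c
  have hL : LinearMap.range L = ⊤ := by rw [Fintype.range_linearCombination, hv]
  obtain ⟨R, hR⟩ := L.exists_rightInverse_of_surjective hL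
  have hLR : ∀ x, L (R x) = x := fun x => by
    simpa using LinearMap.congr_fun hR x
  -- Equal norms give `ker L ⊆ ker M`, so `M ∘ R` does not depend on the choice of the right inverse
  -- `R`.
  have hg : ∀ c, M (R (L c)) = M c := fun c => by
    rw [← sub_eq_zero, ← map_sub, ← norm_eq_zero, ← hnorm, map_sub, hLR, sub_self, norm_zero]
  let g : V →ₗᵢ[ℝ] V := ⟨M ∘ₗ R, fun x => by
    rw [LinearMap.comp_apply, ← hnorm, hLR]⟩
  refine ⟨g.toLinearIsometryEquiv rfl, fun i => ?_⟩
  have h1 : L (Pi.single i 1) = v i := by simp [L]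
  have h2 : M (Pi.single i 1) = w i := by simp [M]
  rw [LinearIsometry.toLinearIsometryEquiv_apply, ← h1, ← h2]
  exact hg _

theorem span_range_eq_top_of_affineIndependent [FiniteDimensional ℝ V] [Fintype ι] {v : ι → V}
    (hv : AffineIndependent ℝ v) (hc : Fintype.card ι = finrank ℝ V + 1) :
    Submodule.span ℝ (range v) = ⊤ := by
  have h := hv.affineSpan_eq_top_iff_card_eq_finrank_add_one.2 hc
  rw [eq_top_iff]
  intro x _
  have hx : x ∈ affineSpan ℝ (range v) := h ▸ AffineSubspace.mem_top ℝ V x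
  exact affineSpan_subset_span hx

/-- The sum has the same inner product with every `v i`, so it is orthogonal to all differences, and
these span `V`. -/
theorem IsRegularFrame.sum_eq_zero [FiniteDimensional ℝ V] [Fintype ι] {v : ι → V} {r : ℝ}
    (h : IsRegularFrame r v) (hv : AffineIndependent ℝ v)
    (hc : Fintype.card ι = finrank ℝ V + 1) : ∑ i, v i = 0 := by
  classical
  obtain ⟨hr, c, hcc⟩ := h
  have hspan := hv.vectorSpan_eq_top_of_card_eq_finrank_add_one hc
  have hin : ∀ i, ⟪∑ k, v k, v i⟫ = r ^ 2 + (Fintype.card ι - 1 : ℝ) * c := fun i => by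
    rw [sum_inner, ← Finset.add_sum_erase _ _ (Finset.mem_univ i), real_inner_self_eq_norm_sq, hr,
      Finset.sum_congr rfl fun k hk => hcc k i (Finset.ne_of_mem_erase hk)]
    have : 0 < Fintype.card ι := by omega
    simp [Finset.card_erase_of_mem, Nat.cast_sub (Nat.succ_le_of_lt this)]
  have horth : ∀ y ∈ vectorSpan ℝ (range v), ⟪∑ k, v k, y⟫ = 0 := by
    intro y hy
    rw [vectorSpan_def] at hy
    induction hy using Submodule.span_induction with
    | mem y hy =>
      obtain ⟨_, ⟨i, rfl⟩, _, ⟨j, rfl⟩, rfl⟩ := hy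
      simp [inner_sub_right, hin]
    | zero => simp
    | add a b _ _ ha hb => rw [inner_add_right, ha, hb, add_zero]
    | smul t a _ ha => rw [real_inner_smul_right, ha, mul_zero]
  exact inner_self_eq_zero.1 (horth _ (hspan ▸ Submodule.mem_top))

theorem IsRegularFrame.inner_eq [FiniteDimensional ℝ V] [Fintype ι] {v : ι → V} {r : ℝ}
    (h : IsRegularFrame r v) (hv : AffineIndependent ℝ v)
    (hc : Fintype.card ι = finrank ℝ V + 1) {i j : ι} (hij : i ≠ j) :
    ⟪v i, v j⟫ = - r ^ 2 / finrank ℝ V := by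
  classical
  have hs := h.sum_eq_zero hv hc
  obtain ⟨hr, c, hcc⟩ := h
  have hcard : 1 < Fintype.card ι := Fintype.one_lt_card_iff.2 ⟨i, j, hij⟩
  have h0 : ⟪∑ k, v k, v i⟫ = r ^ 2 + (finrank ℝ V : ℝ) * c := by
    rw [sum_inner, ← Finset.add_sum_erase _ _ (Finset.mem_univ i), real_inner_self_eq_norm_sq, hr,
      Finset.sum_congr rfl fun k hk => hcc k i (Finset.ne_of_mem_erase hk)]
    simp [Finset.card_erase_of_mem, hc]
  rw [hs, inner_zero_left] at h0
  have : (finrank ℝ V : ℝ) ≠ 0 := by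
    have : finrank ℝ V ≠ 0 := by omega
    exact_mod_cast this
  rw [hcc i j hij]
  field_simp
  linarith

theorem IsRegularFrame.exists_linearIsometryEquiv [FiniteDimensional ℝ V] [Fintype ι]
    {v w : ι → V} {r : ℝ} (hv : IsRegularFrame r v) (hva : AffineIndependent ℝ v)
    (hw : IsRegularFrame r w) (hwa : AffineIndependent ℝ w)
    (hc : Fintype.card ι = finrank ℝ V + 1) : ∃ g : V ≃ₗᵢ[ℝ] V, ∀ i, g (v i) = w i := by
  refine exists_linearIsometryEquiv_of_inner_eq (span_range_eq_top_of_affineIndependent hva hc)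
    fun i j => ?_
  obtain rfl | hij := eq_or_ne i j
  · rw [real_inner_self_eq_norm_sq, real_inner_self_eq_norm_sq, hv.1, hw.1]
  · rw [hv.inner_eq hva hc hij, hw.inner_eq hwa hc hij]

/-- If each transposition of two of the vectors is induced by the reflection exchanging them, then
the vectors form a regular frame. -/
theorem isRegularFrame_of_pairwise [Nontrivial ι] {v : ι → V}
    (h : ∀ i j, i ≠ j → ‖v i‖ = ‖v j‖ ∧ ∀ k, k ≠ i → k ≠ j → ⟪v i, v k⟫ = ⟪v j, v k⟫) :
    ∃ ρ, IsRegularFrame ρ v := by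
  obtain ⟨a, b, hab⟩ := exists_pair_ne ι
  refine ⟨‖v a‖, fun i => ?_, ⟪v a, v b⟫, fun i j hij => ?_⟩
  · obtain rfl | hi := eq_or_ne i a
    · rfl
    · exact (h i a hi).1
  -- Changing one index at a time carries any off-diagonal Gram entry to `⟪v a, v b⟫`.
  have key : ∀ i j k, i ≠ j → k ≠ j → ⟪v i, v j⟫ = ⟪v k, v j⟫ := fun i j k hij hkj => by
    obtain rfl | hik := eq_or_ne i k
    · rfl
    · exact (h i k hik).2 j hij.symm hkj.symm
  obtain rfl | haj := eq_or_ne a j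
  · rw [key i a b hij hab.symm, real_inner_comm]
  · rw [key i j a hij haj, real_inner_comm, key j a b haj.symm hab.symm, real_inner_comm]

end InnerProductGeometry

/-! ### Radially decreasing measures and existence of a maximal simplex. -/

section RadialMeasure

open Set Module Metric
open scoped RealInnerProductSpace ENNReal Topology

theorem measurable_radial {V : Type*} [NormedAddCommGroup V] [MeasurableSpace V]
    [OpensMeasurableSpace V] {w : ℝ → ℝ≥0∞} (hw : Antitone w) : Measurable fun p : V => w ‖p‖ :=
  hw.measurable.comp measurable_norm

variable {V : Type*} [NormedAddCommGroup V] [InnerProductSpace ℝ V] [FiniteDimensional ℝ V]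
  [MeasurableSpace V] [BorelSpace V] {ι : Type*}

/-- The measure on `V` whose density at `p` is `w ‖p‖`. -/
noncomputable def radialMeasure (V : Type*) [NormedAddCommGroup V] [InnerProductSpace ℝ V]
    [FiniteDimensional ℝ V] [MeasurableSpace V] [BorelSpace V] (w : ℝ → ℝ≥0∞) : Measure V :=
  (volume : Measure V).withDensity fun p => w ‖p‖

theorem radialMeasure_apply (w : ℝ → ℝ≥0∞) (s : Set V) :
    radialMeasure V w s = ∫⁻ p in s, w ‖p‖ :=
  withDensity_apply' _ s

theorem isFiniteMeasureOnCompacts_radialMeasure {w : ℝ → ℝ≥0∞} (hw : Antitone w)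
    (hw0 : w 0 ≠ ∞) : IsFiniteMeasureOnCompacts (radialMeasure V w) := by
  refine ⟨fun K hK => ?_⟩
  rw [radialMeasure_apply]
  refine setLIntegral_lt_top_of_le_nnreal hK.measure_lt_top.ne ⟨(w 0).toNNReal, fun x _ => ?_⟩
  rw [ENNReal.coe_toNNReal hw0]
  exact hw (norm_nonneg x)

theorem radialMeasure_image_linearIsometryEquiv (w : ℝ → ℝ≥0∞) (g : V ≃ₗᵢ[ℝ] V) (s : Set V) :
    radialMeasure V w (g '' s) = radialMeasure V w s := by
  rw [radialMeasure_apply, radialMeasure_apply,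
    ← g.measurePreserving.setLIntegral_comp_preimage_emb g.toHomeomorph.measurableEmbedding,
    preimage_image_eq _ g.injective]
  simp

theorem radialMeasure_convexHull_eq_of_isometry (w : ℝ → ℝ≥0∞) {v v' : ι → V} (g : V ≃ₗᵢ[ℝ] V)
    (h : ∀ i, g (v i) = v' i) :
    radialMeasure V w (convexHull ℝ (range v)) = radialMeasure V w (convexHull ℝ (range v')) := by
  rw [← radialMeasure_image_linearIsometryEquiv w g]
  have h1 := g.toLinearEquiv.toLinearMap.image_convexHull (range v)
  have h2 : range v' = g '' range v := by
    rw [← range_comp]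
    exact congrArg range (funext fun i => (h i).symm)
  rw [h2]
  exact congrArg _ h1

theorem radialMeasure_pos {w : ℝ → ℝ≥0∞} (hw : Antitone w) {r : ℝ} (hr : StrictAntiOn w (Icc 0 r))
    {s : Set V} (hs : s ⊆ ball 0 r) (h0 : volume s ≠ 0) : 0 < radialMeasure V w s := by
  rw [radialMeasure_apply, setLIntegral_pos_iff (measurable_radial hw)]
  rw [inter_eq_self_of_subset_right]
  · exact h0.bot_lt
  · intro p hp
    have hp' : ‖p‖ < r := by simpa using hs hp
    exact (lt_of_le_of_lt (zero_le) (hr ⟨norm_nonneg p, hp'.le⟩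
      ⟨(norm_nonneg p).trans hp'.le, le_rfl⟩ hp')).ne'

theorem radialMeasure_convexHull_pos {w : ℝ → ℝ≥0∞} (hw : Antitone w) {r : ℝ}
    (hr : StrictAntiOn w (Icc 0 r)) (hr0 : 0 < r) [Fintype ι] {v : ι → V}
    (hv : AffineIndependent ℝ v)
    (hc : Fintype.card ι = finrank ℝ V + 1) (hb : ∀ i, ‖v i‖ ≤ r) :
    0 < radialMeasure V w (convexHull ℝ (range v)) := by
  have hne : (interior (convexHull ℝ (range v))).Nonempty :=
    interior_convexHull_nonempty_iff_affineSpan_eq_top.2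
      (hv.affineSpan_eq_top_iff_card_eq_finrank_add_one.2 hc)
  -- The density may vanish at distance `r`, so positivity is read off on the interior, which lies
  -- in the open ball.
  refine lt_of_lt_of_le (radialMeasure_pos hw hr (s := interior (convexHull ℝ (range v))) ?_
    (isOpen_interior.measure_pos _ hne).ne') (measure_mono interior_subset)
  rw [← interior_closedBall _ hr0.ne']
  refine interior_mono (convexHull_min ?_ (convex_closedBall _ _))
  rintro _ ⟨i, rfl⟩
  simpa using hb i

theorem affineIndependent_of_radialMeasure_ne_zero {w : ℝ → ℝ≥0∞} [Fintype ι] {v : ι → V}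
    (hc : Fintype.card ι = finrank ℝ V + 1)
    (h : radialMeasure V w (convexHull ℝ (range v)) ≠ 0) : AffineIndependent ℝ v := by
  rw [affineIndependent_iff_finrank_vectorSpan_eq ℝ v hc]
  have htop : affineSpan ℝ (range v) = ⊤ := by
    by_contra hne
    refine h (withDensity_absolutelyContinuous _ _ ?_)
    exact measure_mono_null (convexHull_subset_affineSpan _) (Measure.addHaar_affineSubspace _ _ hne)
  rw [← direction_affineSpan, htop, AffineSubspace.direction_top, finrank_top]

/-- The measure of the convex hull of a finite family depends upper semicontinuously on it. -/
theorem upperSemicontinuous_measure_convexHull [Fintype ι] (ν : Measure V)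
    [IsFiniteMeasureOnCompacts ν] :
    UpperSemicontinuous fun v : ι → V => ν (convexHull ℝ (range v)) := by
  intro v y hy
  -- Moving the vertices by at most `ε / 2` keeps the hull inside a closed thickening of the
  -- original compact hull, and the measures of these thickenings tend to that of the hull.
  have hK : IsCompact (convexHull ℝ (range v)) := (finite_range v).isCompact_convexHull ℝ
  have h1 := (tendsto_measure_cthickening_of_isCompact (μ := ν) hK).eventually_lt_const hy
  obtain ⟨ε, hε, hlt⟩ := Metric.eventually_nhds_iff.1 h1
  filter_upwards [Metric.closedBall_mem_nhds v (half_pos hε)] with v' hv'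
  refine lt_of_le_of_lt (measure_mono ?_) (hlt (y := ε / 2) (by
    rw [Real.dist_eq, sub_zero, abs_of_pos (half_pos hε)]; linarith))
  refine convexHull_min ?_ ((convex_convexHull ℝ _).cthickening _)
  rintro _ ⟨i, rfl⟩
  exact mem_cthickening_of_dist_le _ (v i) _ _ (subset_convexHull ℝ _ ⟨i, rfl⟩)
    ((dist_le_pi_dist v' v i).trans hv')

theorem exists_isMaxOn_radialMeasure_convexHull [Fintype ι] {w : ℝ → ℝ≥0∞} (hw : Antitone w)
    (hw0 : w 0 ≠ ∞) {r : ℝ} (hr : StrictAntiOn w (Icc 0 r)) (hr0 : 0 < r)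
    (hc : Fintype.card ι = finrank ℝ V + 1) :
    ∃ v : ι → V, AffineIndependent ℝ v ∧ (∀ i, ‖v i‖ ≤ r) ∧ ∀ v' : ι → V, (∀ i, ‖v' i‖ ≤ r) →
      radialMeasure V w (convexHull ℝ (range v')) ≤ radialMeasure V w (convexHull ℝ (range v)) := by
  have := isFiniteMeasureOnCompacts_radialMeasure (V := V) hw hw0
  have hK : IsCompact (Set.pi univ fun _ : ι => closedBall (0 : V) r) :=
    isCompact_univ_pi fun _ => isCompact_closedBall _ _
  have hmem : ∀ v : ι → V, v ∈ (Set.pi univ fun _ : ι => closedBall (0 : V) r) ↔ ∀ i, ‖v i‖ ≤ r :=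
    fun v => by simp
  obtain ⟨v, hv, hmax⟩ := UpperSemicontinuousOn.exists_isMaxOn ⟨0, (hmem 0).2 (by simp [hr0.le])⟩ hK
    ((upperSemicontinuous_measure_convexHull (ι := ι) (radialMeasure V w)).upperSemicontinuousOn _)
  have hle : ∀ v' : ι → V, (∀ i, ‖v' i‖ ≤ r) →
      radialMeasure V w (convexHull ℝ (range v')) ≤ radialMeasure V w (convexHull ℝ (range v)) :=
    fun v' h' => hmax ((hmem v').2 h')
  refine ⟨v, ?_, (hmem v).1 hv, hle⟩
  -- An affine basis rescaled into the ball is a competitor of positive measure, which rules out a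
  -- degenerate maximiser.
  obtain ⟨b⟩ := AffineBasis.exists_affineBasis_of_finiteDimensional (k := ℝ) (P := V) hc
  obtain ⟨M, hM0, hM⟩ : ∃ M > 0, ∀ i, ‖b i‖ ≤ M :=
    ⟨∑ i, ‖b i‖ + 1, by positivity, fun i =>
      (Finset.single_le_sum (fun i _ => norm_nonneg (b i)) (Finset.mem_univ i)).trans (by simp)⟩
  have hrM : 0 < r / M := by positivity
  let e : V ≃ᵃ[ℝ] V := (LinearEquiv.smulOfNeZero ℝ V (r / M) hrM.ne').toAffineEquiv
  have hb : AffineIndependent ℝ (e ∘ b) := e.affineIndependent_iff.2 b.ind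
  have hnorm : ∀ i, ‖(e ∘ b) i‖ ≤ r := fun i => by
    have : (e ∘ b) i = (r / M) • b i := rfl
    rw [this, norm_smul, Real.norm_of_nonneg hrM.le]
    calc r / M * ‖b i‖ ≤ r / M * M := by gcongr; exact hM i
      _ = r := by field_simp
  exact affineIndependent_of_radialMeasure_ne_zero hc
    ((radialMeasure_convexHull_pos hw hr hr0 hb hc hnorm).trans_le (hle _ hnorm)).ne'

theorem measurePreserving_of_involutive_linearMap {f : V →ₗ[ℝ] V} (hf : f ∘ₗ f = LinearMap.id) :
    MeasurePreserving f volume volume := by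
  have hdet : LinearMap.det f * LinearMap.det f = 1 := by
    rw [← LinearMap.det_comp, hf, LinearMap.det_id]
  have hne : LinearMap.det f ≠ 0 := left_ne_zero_of_mul_eq_one hdet
  refine ⟨f.continuous_of_finiteDimensional.measurable, ?_⟩
  rw [Measure.map_linearMap_addHaar_eq_smul_addHaar _ hne]
  have : |(LinearMap.det f)⁻¹| = 1 := by
    rw [abs_inv, inv_eq_one]
    obtain h | h := mul_self_eq_one_iff.1 hdet <;> simp [h]
  simp [this]

theorem measurePreserving_of_involutive_affineMap {f : V →ᵃ[ℝ] V} (hf : Function.Involutive f) :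
    MeasurePreserving f volume volume := by
  have hlin : f.linear ∘ₗ f.linear = LinearMap.id := by
    have h : f.comp f = AffineMap.id ℝ V := AffineMap.ext hf
    simpa using congrArg AffineMap.linear h
  have h := (measurePreserving_add_right (volume : Measure V) (f 0)).comp
    (measurePreserving_of_involutive_linearMap hlin)
  convert! h using 1
  exact AffineMap.decomp f

/-- Moving mass towards the origin along a measure preserving involution increases a radially
decreasing measure. -/
theorem radialMeasure_lt_of_involution {w : ℝ → ℝ≥0∞} (hw : Antitone w) (hw0 : w 0 ≠ ∞) {r : ℝ}
    (hr : StrictAntiOn w (Icc 0 r)) {τ : V → V} (hτ : MeasurePreserving τ volume volume)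
    (hinv : Function.Involutive τ) {s t : Set V} (hs : MeasurableSet s) (ht : IsCompact t)
    (hst : τ ⁻¹' s = t) (hsr : s ⊆ closedBall 0 r) (hlt : ∀ p ∈ t \ s, ‖p‖ < ‖τ p‖)
    (h0 : volume (t \ s) ≠ 0) : radialMeasure V w s < radialMeasure V w t := by
  have := isFiniteMeasureOnCompacts_radialMeasure (V := V) hw hw0
  have hts : τ ⁻¹' t = s := by rw [← hst, ← preimage_comp, hinv.comp_self, preimage_id]
  have hfin : ∀ u ⊆ t, radialMeasure V w u ≠ ∞ := fun u hu =>
    ((measure_mono hu).trans_lt ht.measure_lt_top).ne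
  rw [← measure_inter_add_sdiff s ht.measurableSet, ← measure_inter_add_sdiff t hs, inter_comm]
  refine ENNReal.add_lt_add_left (hfin _ inter_subset_left) ?_
  -- The common part `s ∩ t` cancels, and `τ` exchanges `t \ s` with `s \ t`.
  have hswap : radialMeasure V w (s \ t) = ∫⁻ p in t \ s, w ‖τ p‖ := by
    rw [radialMeasure_apply, ← hτ.setLIntegral_comp_preimage (hs.diff ht.measurableSet)
      (measurable_radial hw), preimage_sdiff, hst, hts]
  rw [hswap, radialMeasure_apply]
  have hfin' : ∫⁻ p in t \ s, w ‖τ p‖ ≠ ∞ := by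
    refine ne_top_of_le_ne_top (hfin (t \ s) sdiff_subset) ?_
    rw [radialMeasure_apply]
    exact setLIntegral_mono (measurable_radial hw) fun p hp => hw (hlt p hp).le
  refine setLIntegral_strict_mono (ht.measurableSet.diff hs) h0 (measurable_radial hw) hfin'
    (ae_of_all _ fun p hp => ?_)
  have hp' : τ p ∈ s := by
    have := hp.1
    rwa [← hst] at this
  have : ‖τ p‖ ≤ r := by simpa using hsr hp'
  exact hr ⟨norm_nonneg _, (hlt p hp).le.trans this⟩ ⟨norm_nonneg _, this⟩ (hlt p hp)

end RadialMeasure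

/-! ### Steiner symmetrization of a simplex along an edge. -/

section Symmetrization

open Set Module Metric
open scoped RealInnerProductSpace ENNReal Topology

variable {V : Type*} [NormedAddCommGroup V] [InnerProductSpace ℝ V] {ι : Type*}

/-- The shear `p ↦ p - a p • u`. -/
noncomputable def shearAlong (u : V) (a : V →ᵃ[ℝ] ℝ) : V →ᵃ[ℝ] V :=
  AffineMap.id ℝ V - (LinearMap.toSpanSingleton ℝ V u).toAffineMap.comp a

/-- On each line in direction `u`, the reflection exchanging `0` and `a`, where the coordinate on
the line is the inner product with `u`. -/
noncomputable def fiberReflection (u : V) (a : V →ᵃ[ℝ] ℝ) : V →ᵃ[ℝ] V :=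
  shearAlong u ((2 : ℝ) • (innerSL ℝ u).toLinearMap.toAffineMap - a)

theorem shearAlong_apply (u : V) (a : V →ᵃ[ℝ] ℝ) (p : V) : shearAlong u a p = p - a p • u := by
  simp [shearAlong]

theorem fiberReflection_apply (u : V) (a : V →ᵃ[ℝ] ℝ) (p : V) :
    fiberReflection u a p = p + (a p - 2 * ⟪u, p⟫) • u := by
  rw [fiberReflection, shearAlong_apply]
  have : ((2 : ℝ) • (innerSL ℝ u).toLinearMap.toAffineMap - a) p = 2 * ⟪u, p⟫ - a p := rfl
  rw [this]
  module

theorem AffineMap.apply_add_smul_of_linear_eq_zero {u : V} {a : V →ᵃ[ℝ] ℝ} (ha : a.linear u = 0)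
    (p : V) (t : ℝ) : a (p + t • u) = a p := by
  rw [add_comm, ← vadd_eq_add, a.map_vadd]
  simp [ha]

theorem involutive_fiberReflection {u : V} (hu : ‖u‖ = 1) {a : V →ᵃ[ℝ] ℝ} (ha : a.linear u = 0) :
    Function.Involutive (fiberReflection u a) := by
  intro p
  rw [fiberReflection_apply u a (fiberReflection u a p), fiberReflection_apply,
    AffineMap.apply_add_smul_of_linear_eq_zero ha, inner_add_right, real_inner_smul_right,
    real_inner_self_eq_norm_sq, hu]
  module

/-- On each fibre, the reflections about `a / 2` and then about `0` compose to the translation by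
`-a`. -/
theorem fiberReflection_zero_fiberReflection {u : V} (hu : ‖u‖ = 1) (a : V →ᵃ[ℝ] ℝ) (p : V) :
    fiberReflection u 0 (fiberReflection u a p) = shearAlong u a p := by
  rw [fiberReflection_apply u 0, fiberReflection_apply, shearAlong_apply, inner_add_right,
    real_inner_smul_right, real_inner_self_eq_norm_sq, hu]
  simp only [AffineMap.coe_zero, Pi.zero_apply]
  module

/-- If the image were no farther from the origin than `p`, it would lie on the segment from `p` to
its mirror image in the hyperplane orthogonal to `u`, hence in the convex symmetric set `t`. -/
theorem norm_lt_norm_fiberReflection {u : V} (hu : ‖u‖ = 1) {a : V →ᵃ[ℝ] ℝ} {t : Set V}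
    (ht : Convex ℝ t) (hsymm : ∀ p ∈ t, fiberReflection u 0 p ∈ t) {p : V} (hp : p ∈ t)
    (hpt : fiberReflection u a p ∉ t) : ‖p‖ < ‖fiberReflection u a p‖ := by
  by_contra! hle
  apply hpt
  set s := ⟪u, p⟫ with hs
  have hsq : ‖fiberReflection u a p‖ ^ 2 = ‖p‖ ^ 2 + (a p - 2 * s) * a p := by
    rw [fiberReflection_apply, norm_add_sq_real, real_inner_smul_right, real_inner_comm u p, ← hs,
      norm_smul, hu, Real.norm_eq_abs, mul_one, sq_abs]
    ring
  have hle2 : (a p - 2 * s) * a p ≤ 0 := by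
    have := pow_le_pow_left₀ (norm_nonneg _) hle 2
    linarith
  -- `θ` is the weight of the mirror image. Comparing coordinates, `a p - s = (1 - θ) s - θ s`, so
  -- `θ = 1 - a p / (2 s)` when `s ≠ 0`.
  have hcomb : ∀ θ : ℝ, a p - 2 * s = - (2 * s) * θ →
      fiberReflection u a p = (1 - θ) • p + θ • fiberReflection u 0 p := by
    intro θ hθ
    rw [fiberReflection_apply, fiberReflection_apply, ← hs, hθ]
    simp only [AffineMap.coe_zero, Pi.zero_apply]
    module
  obtain h0 | h0 := eq_or_ne s 0
  · have ha0 : a p = 0 := by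
      rw [h0] at hle2
      nlinarith [sq_nonneg (a p)]
    rw [fiberReflection_apply, ← hs, ha0, h0]
    simpa using hp
  · have hθ0 : 0 ≤ 1 - a p / (2 * s) := by
      rw [sub_nonneg]
      obtain h | h := lt_or_gt_of_ne h0
      · rw [div_le_one_of_neg (by linarith)]
        nlinarith
      · rw [div_le_one (by linarith)]
        nlinarith
    have hθ1 : 0 ≤ a p / (2 * s) := by
      obtain h | h := lt_or_gt_of_ne h0
      · exact div_nonneg_of_nonpos (by nlinarith) (by linarith)
      · exact div_nonneg (by nlinarith) (by linarith)
    rw [hcomb (1 - a p / (2 * s)) (by field_simp; ring)]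
    exact ht hp (hsymm p hp) (by linarith) hθ0 (by ring)

/-- Since `a` is constant along `u`, the `m`-th iterate of the shear moves `p` by `-m a(p) u`, which
leaves every bounded set unless `a p = 0`. -/
theorem eq_zero_of_mapsTo_shearAlong {u : V} (hu : u ≠ 0) {a : V →ᵃ[ℝ] ℝ} (ha : a.linear u = 0)
    {s : Set V} (hs : Bornology.IsBounded s) (h : MapsTo (shearAlong u a) s s) {p : V}
    (hp : p ∈ s) : a p = 0 := by
  have hiter : ∀ m : ℕ, p + (-(m * a p)) • u ∈ s := by
    intro m
    induction m with
    | zero => simpa using hp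
    | succ m ih =>
      have := h ih
      rw [shearAlong_apply, AffineMap.apply_add_smul_of_linear_eq_zero ha] at this
      convert! this using 1
      push_cast
      module
  obtain ⟨R, hR⟩ := hs.exists_norm_le
  by_contra hne
  have hpos : 0 < |a p| * ‖u‖ := mul_pos (abs_pos.2 hne) (norm_pos_iff.2 hu)
  obtain ⟨m, hm⟩ := exists_nat_gt ((R + ‖p‖) / (|a p| * ‖u‖))
  rw [div_lt_iff₀ hpos] at hm
  have h1 := hR _ (hiter m)
  have h2 : ‖(-(m * a p)) • u‖ = m * (|a p| * ‖u‖) := by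
    rw [norm_smul, Real.norm_eq_abs, abs_neg, abs_mul, Nat.abs_cast]
    ring
  have h3 := norm_sub_le (p + (-(m * a p)) • u) p
  rw [add_sub_cancel_left, h2] at h3
  linarith

theorem exists_affineMap_apply_eq [FiniteDimensional ℝ V] [Fintype ι] {v : ι → V} (hv : AffineIndependent ℝ v)
    (hc : Fintype.card ι = finrank ℝ V + 1) (α : ι → ℝ) :
    ∃ a : V →ᵃ[ℝ] ℝ, ∀ i, a (v i) = α i := by
  classical
  let b : AffineBasis ι ℝ V := ⟨v, hv, hv.affineSpan_eq_top_iff_card_eq_finrank_add_one.2 hc⟩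
  have hb : ∀ i, b i = v i := fun _ => rfl
  refine ⟨∑ k, α k • b.coord k, fun i => ?_⟩
  have : ∀ f : ι → (V →ᵃ[ℝ] ℝ), ∀ p, (∑ k, f k) p = ∑ k, f k p := fun f p =>
    map_sum (⟨⟨fun g : V →ᵃ[ℝ] ℝ => g p, rfl⟩, fun _ _ => rfl⟩ : (V →ᵃ[ℝ] ℝ) →+ ℝ) f _
  rw [this, ← hb]
  simp [AffineBasis.coord_apply]

variable [FiniteDimensional ℝ V] [MeasurableSpace V] [BorelSpace V]

/-- The hypothesis `himage` says that the fibres of `s` in direction `u` are symmetric about the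
coordinate `a`. The shear recentres them at `0`, and the reflection about `a / 2` exchanges `s` with
its symmetral `t`, taking points of `t \ s` farther out. -/
theorem radialMeasure_lt_shearAlong {w : ℝ → ℝ≥0∞} (hw : Antitone w) (hw0 : w 0 ≠ ∞) {r : ℝ}
    (hr : StrictAntiOn w (Icc 0 r)) {u : V} (hu : ‖u‖ = 1) {a : V →ᵃ[ℝ] ℝ}
    (ha : a.linear u = 0) {s : Set V} (hsc : IsCompact s) (hsx : Convex ℝ s)
    (hsi : (interior s).Nonempty) (hsr : s ⊆ closedBall 0 r)
    (himage : fiberReflection u a '' s = shearAlong u a '' s) (hne : ∃ p ∈ s, a p ≠ 0) :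
    radialMeasure V w s < radialMeasure V w (shearAlong u a '' s) := by
  set t := shearAlong u a '' s with ht
  have hinv := involutive_fiberReflection hu ha
  have hpre : fiberReflection u a ⁻¹' s = t := by
    rw [← himage, ← hinv.image_eq_preimage_symm]
  have hcont : Continuous (fiberReflection u a) := AffineMap.continuous_of_finiteDimensional _
  have htc : IsCompact t := by rw [← himage]; exact hsc.image hcont
  have htx : Convex ℝ t := hsx.affine_image _
  have hsymm : ∀ p ∈ t, fiberReflection u 0 p ∈ t := by
    intro p hp
    rw [← himage] at hp
    obtain ⟨q, hq, rfl⟩ := hp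
    rw [fiberReflection_zero_fiberReflection hu]
    exact mem_image_of_mem _ hq
  have hmem : ∀ p, fiberReflection u a p ∈ t ↔ p ∈ s := fun p => by
    rw [← hpre, mem_preimage, hinv]
  refine radialMeasure_lt_of_involution hw hw0 hr
    (measurePreserving_of_involutive_affineMap hinv) hinv hsc.measurableSet htc hpre hsr
    (fun p hp => norm_lt_norm_fiberReflection hu htx hsymm hp.1 fun h => hp.2 ((hmem p).1 h)) ?_
  -- If `t \ s` is null, then `interior t ⊆ s`, hence `t ⊆ s` because `t` is a closed convex body.
  -- The shear then maps `s` into itself, which forces `a = 0` on `s`.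
  intro h0
  obtain ⟨p, hp, hap⟩ := hne
  refine hap (eq_zero_of_mapsTo_shearAlong (norm_ne_zero_iff.1 (by simp [hu])) ha hsc.isBounded ?_
    hp)
  have hint : (interior t).Nonempty := by
    rw [← hpre]
    obtain ⟨q, hq⟩ := hsi
    refine ⟨fiberReflection u a q, ?_⟩
    exact preimage_interior_subset_interior_preimage hcont (by rwa [mem_preimage, hinv])
  have hsub : interior t ⊆ s := by
    have hopen : IsOpen (interior t \ s) := isOpen_interior.sdiff hsc.isClosed
    have : interior t \ s = ∅ := hopen.measure_eq_zero_iff (μ := volume) |>.1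
      (measure_mono_null (sdiff_subset_sdiff_left interior_subset) h0)
    exact sdiff_eq_empty.1 this
  have hts : t ⊆ s := by
    rw [← htc.isClosed.closure_eq, ← htx.closure_interior_eq_closure_of_nonempty_interior hint]
    exact closure_minimal hsub hsc.isClosed
  exact fun q hq => hts (mem_image_of_mem _ hq)

/-- Symmetrizing a simplex with respect to the hyperplane through the origin orthogonal to one of
its edges increases its radially decreasing measure. -/
theorem exists_radialMeasure_lt_of_not_symmetric [Fintype ι] {w : ℝ → ℝ≥0∞} (hw : Antitone w)
    (hw0 : w 0 ≠ ∞) {r : ℝ} (hr : StrictAntiOn w (Icc 0 r)) {v : ι → V}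
    (hv : AffineIndependent ℝ v) (hc : Fintype.card ι = finrank ℝ V + 1) (hb : ∀ i, ‖v i‖ ≤ r)
    {i j : ι} (hij : i ≠ j)
    (hne : ¬ (‖v i‖ = ‖v j‖ ∧ ∀ k, k ≠ i → k ≠ j → ⟪v i, v k⟫ = ⟪v j, v k⟫)) :
    ∃ v' : ι → V, (∀ i, ‖v' i‖ ≤ r) ∧
      radialMeasure V w (convexHull ℝ (range v)) < radialMeasure V w (convexHull ℝ (range v')) := by
  classical
  set ℓ := ‖v i - v j‖ with hℓ
  have hℓ0 : ℓ ≠ 0 := norm_ne_zero_iff.2 (sub_ne_zero.2 (hv.injective.ne hij))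
  set u : V := ℓ⁻¹ • (v i - v j) with hudef
  have hu : ‖u‖ = 1 := by
    rw [hudef, norm_smul, norm_inv, hℓ, norm_norm]
    exact inv_mul_cancel₀ hℓ0
  have hvu : v i - v j = ℓ • u := by rw [hudef, smul_smul, mul_inv_cancel₀ hℓ0, one_smul]
  set e := Equiv.swap i j with he
  have hee : ∀ k, e (e k) = k := fun k => by
    rw [he, ← Equiv.Perm.mul_apply, Equiv.swap_mul_self, Equiv.Perm.one_apply]
  have huu : ⟪u, u⟫ = 1 := by rw [real_inner_self_eq_norm_sq, hu, one_pow]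
  have hswap : ∀ k, v k - v (e k) = (⟪u, v k⟫ - ⟪u, v (e k)⟫) • u := by
    intro k
    rw [← inner_sub_right]
    obtain rfl | hki := eq_or_ne k i
    · rw [he, Equiv.swap_apply_left, hvu, real_inner_smul_right, huu, mul_one]
    obtain rfl | hkj := eq_or_ne k j
    · rw [he, Equiv.swap_apply_right, ← neg_sub, hvu, inner_neg_right, real_inner_smul_right, huu]
      module
    · rw [he, Equiv.swap_apply_of_ne_of_ne hki hkj, sub_self, inner_zero_right, zero_smul]
  -- Every `v k - v (e k)` is parallel to `u`, so swapping `i` and `j` acts along the fibres. The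
  -- affine map `a` interpolates the midpoint coordinates; it takes equal values at `v i` and `v j`,
  -- hence is constant along `u`.
  obtain ⟨a, ha⟩ := exists_affineMap_apply_eq hv hc fun k => (⟪u, v k⟫ + ⟪u, v (e k)⟫) / 2
  have hae : ∀ k, a (v (e k)) = a (v k) := fun k => by rw [ha, ha, hee, add_comm]
  have hau : a.linear u = 0 := by
    have : a.linear (v i - v j) = a (v i) - a (v j) := by
      simpa using a.linearMap_vsub (v i) (v j)
    have hj : a (v j) = a (v i) := by simpa [he] using hae i
    rw [hudef, map_smul, this, hj, sub_self, smul_zero]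
  have hrefl : ∀ k, fiberReflection u a (v k) = shearAlong u a (v (e k)) := fun k => by
    rw [fiberReflection_apply, shearAlong_apply, hae, ← sub_eq_zero]
    have : v k + (a (v k) - 2 * ⟪u, v k⟫) • u - (v (e k) - a (v k) • u)
        = (v k - v (e k)) + (2 * a (v k) - 2 * ⟪u, v k⟫) • u := by module
    rw [this, hswap, ha]
    module
  have himg : ∀ f : V →ᵃ[ℝ] V, f '' convexHull ℝ (range v) = convexHull ℝ (range (f ∘ v)) :=
    fun f => by rw [f.image_convexHull, range_comp]
  refine ⟨shearAlong u a ∘ v, fun k => ?_, ?_⟩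
  -- A new vertex is the midpoint of `v k` and the mirror image of `v (e k)`, two points of the
  -- ball.
  · have hmid : (shearAlong u a ∘ v) k
        = (1 / 2 : ℝ) • (v k + fiberReflection u 0 (v (e k))) := by
      have h1 : v (e k) = v k - (⟪u, v k⟫ - ⟪u, v (e k)⟫) • u := by rw [← hswap]; abel
      rw [Function.comp_apply, shearAlong_apply, ha, fiberReflection_apply]
      simp only [AffineMap.coe_zero, Pi.zero_apply]
      generalize ⟪u, v (e k)⟫ = y at *
      rw [h1]
      module
    have hnorm : ‖fiberReflection u 0 (v (e k))‖ = ‖v (e k)‖ := by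
      rw [← sq_eq_sq₀ (norm_nonneg _) (norm_nonneg _), fiberReflection_apply, norm_add_sq_real,
        real_inner_smul_right, real_inner_comm, norm_smul, hu, Real.norm_eq_abs, mul_one, sq_abs]
      simp only [AffineMap.coe_zero, Pi.zero_apply]
      ring
    rw [hmid, norm_smul, Real.norm_of_nonneg (by norm_num)]
    have := norm_add_le (v k) (fiberReflection u 0 (v (e k)))
    have := hb k
    have := hb (e k)
    linarith
  · rw [← himg]
    refine radialMeasure_lt_shearAlong hw hw0 hr hu hau ((finite_range v).isCompact_convexHull ℝ)
      (convex_convexHull ℝ _) (interior_convexHull_nonempty_iff_affineSpan_eq_top.2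
      (hv.affineSpan_eq_top_iff_card_eq_finrank_add_one.2 hc)) (convexHull_min ?_
      (convex_closedBall _ _)) ?_ ?_
    · rintro _ ⟨k, rfl⟩
      simpa using hb k
    · rw [himg, himg]
      congr 1
      rw [show fiberReflection u a ∘ v = (shearAlong u a ∘ v) ∘ e from funext hrefl,
        e.surjective.range_comp]
    -- If `a` vanishes at the vertices, then `v i + v j ⊥ u`, which gives equal norms, and every
    -- other `v k` is orthogonal to `u`.
    · by_contra! h0
      have h0' : ∀ k, ⟪u, v k⟫ + ⟪u, v (e k)⟫ = 0 := fun k => by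
        have := h0 (v k) (subset_convexHull ℝ _ ⟨k, rfl⟩)
        rw [ha] at this
        linarith
      refine hne ⟨?_, fun k hki hkj => ?_⟩
      · have h1 := h0' i
        rw [he, Equiv.swap_apply_left, ← inner_add_right] at h1
        have h2 : ⟪v i - v j, v i + v j⟫ = 0 := by rw [hvu, real_inner_smul_left, h1, mul_zero]
        rw [← sq_eq_sq₀ (norm_nonneg _) (norm_nonneg _), ← real_inner_self_eq_norm_sq,
          ← real_inner_self_eq_norm_sq]
        rw [inner_sub_left, inner_add_right, inner_add_right, real_inner_comm (v i) (v j)] at h2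
        linarith
      · have h1 := h0' k
        rw [he, Equiv.swap_apply_of_ne_of_ne hki hkj] at h1
        rw [← sub_eq_zero, ← inner_sub_left, hvu, real_inner_smul_left]
        rw [show ⟪u, v k⟫ = 0 by linarith, mul_zero]

end Symmetrization

/-! ### Maximal simplices are the regular inscribed ones. -/

section Extremal

open Set Module Metric
open scoped RealInnerProductSpace ENNReal Topology Pointwise

variable {V : Type*} [NormedAddCommGroup V] [InnerProductSpace ℝ V] [FiniteDimensional ℝ V]
  [MeasurableSpace V] [BorelSpace V] {ι : Type*}

/-- Enlarging a simplex that contains the origin increases its radially decreasing measure. -/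
theorem radialMeasure_convexHull_lt_smul [Fintype ι] {w : ℝ → ℝ≥0∞} (hw : Antitone w)
    (hw0 : w 0 ≠ ∞) {r : ℝ} (hr : StrictAntiOn w (Icc 0 r)) {v : ι → V}
    (hv : AffineIndependent ℝ v) (hc : Fintype.card ι = finrank ℝ V + 1) [Nontrivial V]
    (h0 : (0 : V) ∈ convexHull ℝ (range v)) {t : ℝ} (ht : 1 < t) (hb : ∀ i, t * ‖v i‖ < r) :
    radialMeasure V w (convexHull ℝ (range v)) <
      radialMeasure V w (convexHull ℝ (range fun i => t • v i)) := by
  have := isFiniteMeasureOnCompacts_radialMeasure (V := V) hw hw0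
  have ht0 : 0 < t := by linarith
  set s := convexHull ℝ (range v) with hs
  have hsc : IsCompact s := (finite_range v).isCompact_convexHull ℝ
  have hsx : Convex ℝ s := convex_convexHull ℝ _
  have himg : convexHull ℝ (range fun i => t • v i) = t • s := by
    rw [hs, ← convexHull_smul, ← image_smul, ← range_comp]
    rfl
  have hsub : s ⊆ t • s := by
    intro p hp
    rw [mem_smul_set_iff_inv_smul_mem₀ ht0.ne']
    exact hsx.smul_mem_of_zero_mem h0 hp ⟨by positivity, inv_le_one_of_one_le₀ ht.le⟩
  have hball : t • s ⊆ ball 0 r := by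
    rw [← himg]
    refine convexHull_min ?_ (convex_ball _ _)
    rintro _ ⟨i, rfl⟩
    simpa [norm_smul, abs_of_pos ht0] using hb i
  have hspos : 0 < volume s := by
    have hne : (interior s).Nonempty := interior_convexHull_nonempty_iff_affineSpan_eq_top.2
      (hv.affineSpan_eq_top_iff_card_eq_finrank_add_one.2 hc)
    exact (isOpen_interior.measure_pos _ hne).trans_le (measure_mono interior_subset)
  -- Volume is multiplied by `t ^ finrank ℝ V > 1`, and the added region lies in the open ball,
  -- where the density is positive.
  have hdiff : volume (t • s \ s) ≠ 0 := by
    rw [measure_sdiff hsub hsc.measurableSet.nullMeasurableSet hsc.measure_lt_top.ne]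
    refine (tsub_pos_of_lt ?_).ne'
    rw [Measure.addHaar_smul]
    have h1 : 1 < |t ^ finrank ℝ V| := by
      rw [abs_of_pos (by positivity)]
      exact one_lt_pow₀ ht finrank_pos.ne'
    calc volume s = 1 * volume s := (one_mul _).symm
      _ < _ := (ENNReal.mul_lt_mul_iff_left hspos.ne' hsc.measure_lt_top.ne).2
        (ENNReal.one_lt_ofReal.2 h1)
  rw [himg, ← measure_inter_add_sdiff (t • s) hsc.measurableSet, inter_eq_self_of_subset_right hsub]
  exact ENNReal.lt_add_right hsc.measure_lt_top.ne
    (radialMeasure_pos hw hr (sdiff_subset.trans hball) hdiff).ne'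

theorem isRegularFrame_of_isMaxOn [Fintype ι] {w : ℝ → ℝ≥0∞} (hw : Antitone w)
    (hw0 : w 0 ≠ ∞) {r : ℝ} (hr : StrictAntiOn w (Icc 0 r)) {v : ι → V} [Nontrivial V]
    (hv : AffineIndependent ℝ v) (hc : Fintype.card ι = finrank ℝ V + 1) (hb : ∀ i, ‖v i‖ ≤ r)
    (hmax : ∀ v' : ι → V, (∀ i, ‖v' i‖ ≤ r) →
      radialMeasure V w (convexHull ℝ (range v')) ≤ radialMeasure V w (convexHull ℝ (range v))) :
    IsRegularFrame r v := by
  have hpos : 0 < finrank ℝ V := finrank_pos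
  have : Nontrivial ι := Fintype.one_lt_card_iff_nontrivial.1 (by omega)
  obtain ⟨ρ, hρ⟩ := isRegularFrame_of_pairwise (v := v) fun i j hij => by
    by_contra hne
    obtain ⟨v', hv', hlt⟩ := exists_radialMeasure_lt_of_not_symmetric hw hw0 hr hv hc hb hij hne
    exact (hmax v' hv').not_gt hlt
  obtain ⟨i₀, j₀, hij⟩ := exists_pair_ne ι
  have hρr : ρ ≤ r := hρ.1 i₀ ▸ hb i₀
  obtain rfl | hlt := hρr.eq_or_lt
  · exact hρ
  exfalso
  have hρ0 : 0 < ρ := by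
    refine lt_of_le_of_ne (hρ.1 i₀ ▸ norm_nonneg _) fun h => hij (hv.injective ?_)
    have hz : ∀ i, v i = 0 := fun i => norm_eq_zero.1 ((hρ.1 i).trans h.symm)
    rw [hz, hz]
  have h0 : (0 : V) ∈ convexHull ℝ (range v) := by
    have hcard : (Fintype.card ι : ℝ) ≠ 0 := by
      have : Fintype.card ι ≠ 0 := by omega
      exact_mod_cast this
    have := (convex_convexHull ℝ (range v)).sum_mem (t := Finset.univ)
      (w := fun _ => (Fintype.card ι : ℝ)⁻¹) (z := v) (fun _ _ => by positivity)
      (by simp [hcard]) fun i _ => subset_convexHull ℝ _ ⟨i, rfl⟩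
    rwa [← Finset.smul_sum, hρ.sum_eq_zero hv hc, smul_zero] at this
  -- This factor takes the circumradius `ρ` to the midpoint of `ρ` and `r`, so the enlarged simplex
  -- stays strictly inside the ball.
  have htρ : (ρ + r) / (2 * ρ) * ρ = (ρ + r) / 2 := by field_simp
  have ht : 1 < (ρ + r) / (2 * ρ) := by
    rw [lt_div_iff₀ (by positivity)]
    linarith
  have hbt : ∀ i, (ρ + r) / (2 * ρ) * ‖v i‖ < r := fun i => by
    rw [hρ.1, htρ]
    linarith
  refine (hmax (fun i => ((ρ + r) / (2 * ρ)) • v i) fun i => ?_).not_gt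
    (radialMeasure_convexHull_lt_smul hw hw0 hr hv hc h0 ht hbt)
  rw [norm_smul, Real.norm_of_nonneg (by linarith)]
  exact (hbt i).le

/-- No explicit construction is needed: a maximiser for the auxiliary density `exp (-‖p‖)` is a
regular frame. -/
theorem exists_isRegularFrame [Fintype ι] [Nontrivial V] {r : ℝ} (hr0 : 0 < r)
    (hc : Fintype.card ι = finrank ℝ V + 1) :
    ∃ v : ι → V, AffineIndependent ℝ v ∧ IsRegularFrame r v := by
  let w : ℝ → ℝ≥0∞ := fun t => ENNReal.ofReal (Real.exp (-t))
  have hw : StrictAnti w := fun s t hst =>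
    (ENNReal.ofReal_lt_ofReal_iff (Real.exp_pos _)).2 (Real.exp_lt_exp.2 (neg_lt_neg hst))
  obtain ⟨v, hv, hb, hmax⟩ := exists_isMaxOn_radialMeasure_convexHull (V := V) (ι := ι) hw.antitone
    ENNReal.ofReal_ne_top (hw.strictAntiOn _) hr0 hc
  exact ⟨v, hv, isRegularFrame_of_isMaxOn hw.antitone ENNReal.ofReal_ne_top (hw.strictAntiOn _) hv
    hc hb hmax⟩

/-- Among simplices in a ball, exactly the regular inscribed ones have the greatest radially
decreasing measure. -/
theorem radialMeasure_convexHull_le_and_eq_iff [Fintype ι] [Nontrivial V] {w : ℝ → ℝ≥0∞}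
    (hw : Antitone w) (hw0 : w 0 ≠ ∞) {r : ℝ} (hr0 : 0 < r) (hr : StrictAntiOn w (Icc 0 r))
    (hc : Fintype.card ι = finrank ℝ V + 1) {t v : ι → V} (hta : AffineIndependent ℝ t)
    (ht : IsRegularFrame r t) (hva : AffineIndependent ℝ v) (hb : ∀ i, ‖v i‖ ≤ r) :
    radialMeasure V w (convexHull ℝ (range v)) ≤ radialMeasure V w (convexHull ℝ (range t)) ∧
    (radialMeasure V w (convexHull ℝ (range v)) = radialMeasure V w (convexHull ℝ (range t)) ↔
      IsRegularFrame r v) := by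
  have heq : ∀ {s s' : ι → V}, AffineIndependent ℝ s → IsRegularFrame r s →
      AffineIndependent ℝ s' → IsRegularFrame r s' → radialMeasure V w (convexHull ℝ (range s)) =
      radialMeasure V w (convexHull ℝ (range s')) := fun hsa hs hsa' hs' => by
    obtain ⟨g, hg⟩ := hs.exists_linearIsometryEquiv hsa hs' hsa' hc
    exact radialMeasure_convexHull_eq_of_isometry w g hg
  -- Some maximiser `m` is a regular frame, hence congruent to `t`, so `t` is maximal too. In the
  -- equality case `v` is itself a maximiser.
  obtain ⟨m, hma, hmb, hmax⟩ :=
    exists_isMaxOn_radialMeasure_convexHull (V := V) (ι := ι) hw hw0 hr hr0 hc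
  have hm := isRegularFrame_of_isMaxOn hw hw0 hr hma hc hmb hmax
  have hmt := heq hma hm hta ht
  refine ⟨hmt ▸ hmax v hb, fun h => ?_, fun h => heq hva h hta ht⟩
  exact isRegularFrame_of_isMaxOn hw hw0 hr hva hc hb fun v' hv' => by
    rw [h, ← hmt]
    exact hmax v' hv'

end Extremal

/-! ### Weighted integrals over simplices in a ball. -/

section Ball

open Set Module Metric
open scoped RealInnerProductSpace ENNReal

theorem inner_eq_of_dist_eq_of_norm_eq {V : Type*} [NormedAddCommGroup V] [InnerProductSpace ℝ V]
    {a b : V} {r e : ℝ} (ha : ‖a‖ = r) (hb : ‖b‖ = r) (h : dist a b = e) :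
    ⟪a, b⟫ = r ^ 2 - e ^ 2 / 2 := by
  have := norm_sub_sq_real a b
  rw [← dist_eq_norm, h, ha, hb] at this
  linarith

theorem isRegularInscribedInBall_iff {d : ℕ} {r : ℝ}
    (S : Affine.Simplex ℝ (EuclideanSpace ℝ (Fin d)) d) :
    IsRegularInscribedInBall r S ↔ IsRegularFrame r S.points := by
  have hc : Fintype.card (Fin (d + 1)) = finrank ℝ (EuclideanSpace ℝ (Fin d)) + 1 := by simp
  refine ⟨fun ⟨hreg, hs⟩ => ?_, fun ⟨hr, c, hcc⟩ => ⟨fun σ => ?_, fun i => by simpa using hr i⟩⟩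
  · have hr : ∀ i, ‖S.points i‖ = r := fun i => by simpa using hs i
    obtain ⟨e, he⟩ := hreg.equilateral
    exact ⟨hr, r ^ 2 - e ^ 2 / 2, fun i j hij =>
      inner_eq_of_dist_eq_of_norm_eq (hr i) (hr j) (he i j hij)⟩
  · obtain ⟨g, hg⟩ := exists_linearIsometryEquiv_of_inner_eq (w := S.points ∘ σ)
      (span_range_eq_top_of_affineIndependent S.independent hc) fun i j => by
        obtain rfl | hij := eq_or_ne i j
        · simp [hr]
        · rw [hcc i j hij, Function.comp_apply, Function.comp_apply, hcc _ _ (σ.injective.ne hij)]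
    exact ⟨g.toIsometryEquiv, funext fun i => (hg i).symm⟩

/-- The radial profile of `μ` on the ball of radius `r`, extended to an antitone function. -/
noncomputable def radialProfile {V : Type*} [NormedAddCommGroup V] [NormedSpace ℝ V] (μ : V → ℝ)
    (r : ℝ) (e : V) (t : ℝ) : ℝ≥0∞ :=
  -- Nothing is known of `μ` outside the ball, hence the value `0` beyond `r`; `max t 0` keeps the
  -- profile constant for negative `t`.
  if t ≤ r then ENNReal.ofReal (μ (max t 0 • e)) else 0

namespace IsRadialStrictAntiWeight

variable {d : ℕ} {r : ℝ} {μ : EuclideanSpace ℝ (Fin d) → ℝ} {e : EuclideanSpace ℝ (Fin d)}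

theorem antitone_radialProfile (hμ : IsRadialStrictAntiWeight r μ) (hr : 0 < r) (he : ‖e‖ = 1) :
    Antitone (radialProfile μ r e) := by
  intro s t hst
  unfold radialProfile
  by_cases htr : t ≤ r
  · rw [if_pos htr, if_pos (hst.trans htr)]
    refine ENNReal.ofReal_le_ofReal ?_
    obtain h | h := (max_le_max_right 0 hst).eq_or_lt
    · rw [h]
    · refine (hμ.strictAnti _ ?_ _ ?_ ?_).le <;>
      simp only [mem_closedBall_zero_iff, norm_smul, he, mul_one, Real.norm_eq_abs,
        abs_of_nonneg (le_max_right _ (0 : ℝ)), max_le_iff]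
      exacts [⟨hst.trans htr, hr.le⟩, ⟨htr, hr.le⟩, h]
  · rw [if_neg htr]
    exact zero_le

theorem strictAntiOn_radialProfile (hμ : IsRadialStrictAntiWeight r μ) (he : ‖e‖ = 1) :
    StrictAntiOn (radialProfile μ r e) (Icc 0 r) := by
  intro s hs t ht hst
  have hns : ∀ t : ℝ, 0 ≤ t → ‖t • e‖ = t := fun t ht => by
    rw [norm_smul, he, mul_one, Real.norm_of_nonneg ht]
  have hmem : ∀ t ∈ Icc 0 r, t • e ∈ closedBall (0 : EuclideanSpace ℝ (Fin d)) r := fun t ht => by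
    rw [mem_closedBall_zero_iff, hns t ht.1]
    exact ht.2
  have hlt : μ (t • e) < μ (s • e) :=
    hμ.strictAnti _ (hmem s hs) _ (hmem t ht) (by rwa [hns s hs.1, hns t ht.1])
  rw [radialProfile, radialProfile, if_pos ht.2, if_pos hs.2, max_eq_left ht.1, max_eq_left hs.1]
  exact (ENNReal.ofReal_lt_ofReal_iff ((hμ.nonneg _ (hmem t ht)).trans_lt hlt)).2 hlt

theorem radialProfile_norm (hμ : IsRadialStrictAntiWeight r μ) (he : ‖e‖ = 1)
    {p : EuclideanSpace ℝ (Fin d)} (hp : p ∈ closedBall 0 r) :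
    radialProfile μ r e ‖p‖ = ENNReal.ofReal (μ p) := by
  have hpr : ‖p‖ ≤ r := by simpa using hp
  have hn : ‖‖p‖ • e‖ = ‖p‖ := by rw [norm_smul, he, mul_one, norm_norm]
  rw [radialProfile, if_pos hpr, max_eq_left (norm_nonneg p), hμ.rotation_invariant _ _ _ hp hn]
  rw [mem_closedBall_zero_iff, hn]
  exact hpr

theorem radialProfile_zero_ne_top : radialProfile μ r e 0 ≠ ∞ := by
  unfold radialProfile
  split_ifs <;> simp

/-- Measurability of `μ` is not assumed: on the ball `μ` equals a monotone function of the norm. -/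
theorem aestronglyMeasurable (hμ : IsRadialStrictAntiWeight r μ) (hr : 0 < r) (he : ‖e‖ = 1)
    {s : Set (EuclideanSpace ℝ (Fin d))} (hs : MeasurableSet s) (hsr : s ⊆ closedBall 0 r) :
    AEStronglyMeasurable μ (volume.restrict s) := by
  have hm := (measurable_radial (V := EuclideanSpace ℝ (Fin d))
    (hμ.antitone_radialProfile hr he)).ennreal_toReal
  refine hm.aestronglyMeasurable.congr ?_
  filter_upwards [ae_restrict_mem hs] with p hp
  rw [hμ.radialProfile_norm he (hsr hp), ENNReal.toReal_ofReal (hμ.nonneg p (hsr hp))]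

theorem radialMeasure_radialProfile (hμ : IsRadialStrictAntiWeight r μ) (he : ‖e‖ = 1)
    {s : Set (EuclideanSpace ℝ (Fin d))} (hs : MeasurableSet s) (hsr : s ⊆ closedBall 0 r) :
    radialMeasure _ (radialProfile μ r e) s = ∫⁻ p in s, ENNReal.ofReal (μ p) := by
  rw [radialMeasure_apply]
  exact setLIntegral_congr_fun hs fun p hp => hμ.radialProfile_norm he (hsr hp)

theorem setIntegral_eq (hμ : IsRadialStrictAntiWeight r μ) (hr : 0 < r) (he : ‖e‖ = 1)
    {s : Set (EuclideanSpace ℝ (Fin d))} (hs : MeasurableSet s) (hsr : s ⊆ closedBall 0 r) :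
    ∫ p in s, μ p = (radialMeasure _ (radialProfile μ r e) s).toReal := by
  rw [hμ.radialMeasure_radialProfile he hs hsr, integral_eq_lintegral_of_nonneg_ae _
    (hμ.aestronglyMeasurable hr he hs hsr)]
  filter_upwards [ae_restrict_mem hs] with p hp
  exact hμ.nonneg p (hsr hp)

theorem integrableOn (hμ : IsRadialStrictAntiWeight r μ) (hr : 0 < r) (he : ‖e‖ = 1) :
    IntegrableOn μ (closedBall 0 r) := by
  have := isFiniteMeasureOnCompacts_radialMeasure (V := EuclideanSpace ℝ (Fin d))
    (hμ.antitone_radialProfile hr he) radialProfile_zero_ne_top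
  refine ⟨hμ.aestronglyMeasurable hr he measurableSet_closedBall Subset.rfl, ?_⟩
  rw [hasFiniteIntegral_iff_ofReal, ← hμ.radialMeasure_radialProfile he measurableSet_closedBall
    Subset.rfl]
  · exact (isCompact_closedBall _ _).measure_lt_top
  · filter_upwards [ae_restrict_mem measurableSet_closedBall] with p hp
    exact hμ.nonneg p hp

end IsRadialStrictAntiWeight

theorem setIntegral_simplex_le_and_eq_iff {d : ℕ} (hd : 1 ≤ d) {r : ℝ} (hr : 0 < r)
    {μ : EuclideanSpace ℝ (Fin d) → ℝ} (hμ : IsRadialStrictAntiWeight r μ)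
    (T : Affine.Simplex ℝ (EuclideanSpace ℝ (Fin d)) d) (hT : IsRegularInscribedInBall r T)
    (S : Affine.Simplex ℝ (EuclideanSpace ℝ (Fin d)) d)
    (hS : S.closedInterior ⊆ closedBall 0 r) :
    (∫ p in S.closedInterior, μ p) ≤ (∫ p in T.closedInterior, μ p) ∧
      ((∫ p in S.closedInterior, μ p) = (∫ p in T.closedInterior, μ p) ↔
        IsRegularInscribedInBall r S) := by
  have : Nonempty (Fin d) := ⟨⟨0, hd⟩⟩
  obtain ⟨e, he⟩ := exists_norm_eq (EuclideanSpace ℝ (Fin d)) (zero_le_one' ℝ)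
  have hw := hμ.antitone_radialProfile hr he
  have hw0 : radialProfile μ r e 0 ≠ ∞ := IsRadialStrictAntiWeight.radialProfile_zero_ne_top
  have := isFiniteMeasureOnCompacts_radialMeasure (V := EuclideanSpace ℝ (Fin d)) hw hw0
  have hcpt : ∀ S : Affine.Simplex ℝ (EuclideanSpace ℝ (Fin d)) d, IsCompact S.closedInterior :=
    fun S => by
      rw [← Affine.Simplex.convexHull_eq_closedInterior]
      exact (finite_range S.points).isCompact_convexHull ℝ
  have hTb : T.closedInterior ⊆ closedBall 0 r := by
    rw [← Affine.Simplex.convexHull_eq_closedInterior]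
    refine convexHull_min ?_ (convex_closedBall _ _)
    rintro _ ⟨i, rfl⟩
    exact sphere_subset_closedBall (hT.2 i)
  have hSv : ∀ i, ‖S.points i‖ ≤ r := fun i => by
    simpa using hS (S.point_mem_closedInterior i)
  have key := radialMeasure_convexHull_le_and_eq_iff hw hw0 hr (hμ.strictAntiOn_radialProfile he)
    (by simp) T.independent ((isRegularInscribedInBall_iff T).1 hT) S.independent hSv
  rw [Affine.Simplex.convexHull_eq_closedInterior, Affine.Simplex.convexHull_eq_closedInterior] at key
  rw [hμ.setIntegral_eq hr he (hcpt S).measurableSet hS,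
    hμ.setIntegral_eq hr he (hcpt T).measurableSet hTb, isRegularInscribedInBall_iff S, ← key.2]
  exact ⟨ENNReal.toReal_mono (hcpt T).measure_lt_top.ne key.1,
    ENNReal.toReal_eq_toReal_iff' (hcpt S).measure_lt_top.ne (hcpt T).measure_lt_top.ne⟩

end Ball

/-! ### Central projection and the volume of a cone. -/

section Gnomonic

open Set Module Metric
open scoped RealInnerProductSpace ENNReal Topology Pointwise

/-- The density at distance `t` from the origin of the image of the spherical volume, divided by
`n + 1`, under central projection to a tangent hyperplane of dimension `n`. -/
noncomputable def gnomonicProfile (n : ℕ) (t : ℝ) : ℝ≥0∞ :=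
  ENNReal.ofReal ((√(1 + max t 0 ^ 2))⁻¹ ^ (n + 1) / (n + 1))

theorem strictAntiOn_gnomonicProfile (n : ℕ) : StrictAntiOn (gnomonicProfile n) (Ici 0) := by
  intro s hs t ht hst
  rw [gnomonicProfile, gnomonicProfile, max_eq_left ht, max_eq_left hs]
  rw [mem_Ici] at hs ht
  rw [ENNReal.ofReal_lt_ofReal_iff (by positivity)]
  gcongr

theorem antitone_gnomonicProfile (n : ℕ) : Antitone (gnomonicProfile n) := by
  intro s t hst
  unfold gnomonicProfile
  gcongr

theorem gnomonicProfile_ne_top (n : ℕ) (t : ℝ) : gnomonicProfile n t ≠ ∞ := ENNReal.ofReal_ne_top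

theorem setLIntegral_Ioo_ofReal_pow (n : ℕ) {b : ℝ} (hb : 0 ≤ b) :
    ∫⁻ h in Ioo 0 b, ENNReal.ofReal (h ^ n) = ENNReal.ofReal (b ^ (n + 1) / (n + 1)) := by
  rw [Measure.restrict_congr_set Ioo_ae_eq_Ioc, ← ofReal_integral_eq_lintegral_ofReal,
    ← intervalIntegral.integral_of_le hb, integral_pow]
  · simp
  · exact ((continuous_pow n).integrableOn_Icc (a := 0) (b := b)).mono_set Ioc_subset_Icc_self
  · filter_upwards [ae_restrict_mem measurableSet_Ioc] with h hh
    have := hh.1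
    positivity

variable {E : Type*} [NormedAddCommGroup E] [InnerProductSpace ℝ E]

theorem inner_add_smul_of_mem_orthogonal {x : E} (hx : ‖x‖ = 1) (h : ℝ) (p : (ℝ ∙ x)ᗮ) :
    ⟪x, h • x + (p : E)⟫ = h := by
  rw [inner_add_right, real_inner_smul_right, real_inner_self_eq_norm_sq, hx,
    Submodule.mem_orthogonal_singleton_iff_inner_right.1 p.2]
  ring

theorem inner_smul_add_smul_add {x : E} (hx : ‖x‖ = 1) (a b : ℝ) (p q : (ℝ ∙ x)ᗮ) :
    ⟪a • x + (p : E), b • x + (q : E)⟫ = a * b + ⟪p, q⟫ := by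
  rw [inner_add_left, real_inner_smul_left, inner_add_smul_of_mem_orthogonal hx, inner_add_right,
    real_inner_smul_right, Submodule.mem_orthogonal_singleton_iff_inner_left.1 p.2,
    Submodule.coe_inner]
  ring

theorem norm_sq_smul_add {x : E} (hx : ‖x‖ = 1) (a : ℝ) (p : (ℝ ∙ x)ᗮ) :
    ‖a • x + (p : E)‖ ^ 2 = a ^ 2 + ‖p‖ ^ 2 := by
  rw [← real_inner_self_eq_norm_sq, inner_smul_add_smul_add hx, real_inner_self_eq_norm_sq]
  ring

variable [FiniteDimensional ℝ E] [MeasurableSpace E] [BorelSpace E]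

theorem measurePreserving_smul_add {x : E} (hx : ‖x‖ = 1) :
    MeasurePreserving (fun z : ℝ × (ℝ ∙ x)ᗮ => z.1 • x + (z.2 : E)) volume volume := by
  have h1 : MeasurePreserving (Prod.map (LinearIsometryEquiv.toSpanUnitSingleton (𝕜 := ℝ) x hx)
      (id : (ℝ ∙ x)ᗮ → (ℝ ∙ x)ᗮ)) volume volume :=
    (LinearIsometryEquiv.measurePreserving _).prod (MeasurePreserving.id _)
  have h2 := (ℝ ∙ x).orthogonalDecomposition.symm.measurePreserving.comp
    ((WithLp.volume_preserving_toLp (ℝ ∙ x) (ℝ ∙ x)ᗮ).comp h1)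
  convert! h2 using 1

/-- The volume of a truncated cone over a subset `K` of the hyperplane tangent to the unit sphere
at `x`, expressed by central projection. -/
theorem volume_cone_eq_radialMeasure {x : E} (hx : ‖x‖ = 1) {K : Set (ℝ ∙ x)ᗮ}
    (hK : MeasurableSet K) {C : Set E} (hC : MeasurableSet C)
    (h : ∀ (a : ℝ) (p : (ℝ ∙ x)ᗮ), a • x + (p : E) ∈ C ↔
      0 < a ∧ a⁻¹ • p ∈ K ∧ ‖a • x + (p : E)‖ < 1) :
    volume C = radialMeasure (ℝ ∙ x)ᗮ (gnomonicProfile (finrank ℝ (ℝ ∙ x)ᗮ)) K := by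
  set n := finrank ℝ (ℝ ∙ x)ᗮ
  have hφ := measurePreserving_smul_add hx
  -- By Pythagoras `a • (x + q)` has norm `a √(1 + ‖q‖²)`.
  have hlt : ∀ (a : ℝ) (q : (ℝ ∙ x)ᗮ), 0 < a →
      (‖a • x + ((a • q : (ℝ ∙ x)ᗮ) : E)‖ < 1 ↔ a < (√(1 + ‖q‖ ^ 2))⁻¹) := fun a q ha => by
    rw [← sq_lt_one_iff₀ (norm_nonneg _), norm_sq_smul_add hx, norm_smul,
      Real.norm_of_nonneg ha.le, lt_inv_comm₀ ha (by positivity), Real.sqrt_lt (by positivity)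
      (by positivity), inv_pow, lt_inv_comm₀ (by positivity) (by positivity),
      ← one_div, lt_div_iff₀ (by positivity)]
    ring_nf
  set D : Set (ℝ × (ℝ ∙ x)ᗮ) := {z | z.2 ∈ K ∧ z.1 ∈ Ioo 0 (√(1 + ‖z.2‖ ^ 2))⁻¹} with hD
  have hDm : MeasurableSet D := by
    refine (measurable_snd hK).inter (.inter (measurableSet_lt measurable_const measurable_fst)
      (measurableSet_lt measurable_fst ?_))
    fun_prop
  rw [← hφ.measure_preimage hC.nullMeasurableSet, Measure.volume_eq_prod,
    Measure.prod_apply (hφ.measurable hC)]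
  -- In the coordinates `(a, q)` with `p = a • q` the cone becomes `D`. Its slice at height `a` is
  -- `a` times that of `D`, which yields the Jacobian factor `a ^ n`.
  have hslice : ∀ a : ℝ, volume (Prod.mk a ⁻¹' ((fun z : ℝ × (ℝ ∙ x)ᗮ => z.1 • x + (z.2 : E)) ⁻¹' C))
      = ∫⁻ q, D.indicator (fun z => ENNReal.ofReal (z.1 ^ n)) (a, q) := by
    intro a
    have hDa : MeasurableSet (Prod.mk a ⁻¹' D) := measurable_prodMk_left hDm
    have hind : ∀ q, D.indicator (fun z => ENNReal.ofReal (z.1 ^ n)) (a, q)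
        = (Prod.mk a ⁻¹' D).indicator (fun _ => ENNReal.ofReal (a ^ n)) q := fun q => rfl
    simp only [hind]
    rw [lintegral_indicator_const hDa]
    obtain ha | ha := le_or_gt a 0
    · have h1 : Prod.mk a ⁻¹' D = ∅ := by
        ext q
        simp [hD, ha.not_gt]
      have h2 : Prod.mk a ⁻¹' ((fun z : ℝ × (ℝ ∙ x)ᗮ => z.1 • x + (z.2 : E)) ⁻¹' C) = ∅ := by
        ext q
        simp [h, ha.not_gt]
      rw [h1, h2]
      simp
    · have h1 : Prod.mk a ⁻¹' ((fun z : ℝ × (ℝ ∙ x)ᗮ => z.1 • x + (z.2 : E)) ⁻¹' C)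
          = a • (Prod.mk a ⁻¹' D) := by
        ext q
        rw [mem_smul_set_iff_inv_smul_mem₀ ha.ne', mem_preimage, mem_preimage, h, mem_preimage, hD,
          mem_ofPred, mem_Ioo, ← hlt a _ ha, smul_inv_smul₀ ha.ne']
        tauto
      rw [h1, Measure.addHaar_smul, abs_of_pos (by positivity)]
  simp only [hslice]
  have hfm : Measurable (D.indicator fun z : ℝ × (ℝ ∙ x)ᗮ => ENNReal.ofReal (z.1 ^ n)) :=
    Measurable.indicator (by fun_prop) hDm
  -- Integrating over the height first, `∫ a ^ n` up to `(√(1 + ‖q‖²))⁻¹` is exactly the gnomonic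
  -- density at `q`.
  rw [lintegral_lintegral_swap (f := fun a q =>
    D.indicator (fun z : ℝ × (ℝ ∙ x)ᗮ => ENNReal.ofReal (z.1 ^ n)) (a, q)) hfm.aemeasurable,
    radialMeasure_apply, ← lintegral_indicator hK]
  refine lintegral_congr fun q => ?_
  by_cases hq : q ∈ K
  · rw [indicator_of_mem hq, gnomonicProfile, max_eq_left (norm_nonneg q),
      ← setLIntegral_Ioo_ofReal_pow n (by positivity), ← lintegral_indicator measurableSet_Ioo]
    refine lintegral_congr fun a => ?_
    simp [indicator, hD, hq]
  · rw [indicator_of_notMem hq]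
    simp [indicator, hD, hq]

end Gnomonic

/-! ### Spherical simplices in a cap via central projection. -/

namespace SphericalSimplex

open Set Module Metric
open scoped RealInnerProductSpace ENNReal Topology Pointwise

variable {d : ℕ} {x : UnitSphere d} {α : ℝ} {S : SphericalSimplex d}

/-- The convex cone generated by the vertices of a spherical simplex. -/
def cone (S : SphericalSimplex d) : Set (EuclideanSpace ℝ (Fin d)) :=
  {y | ∃ c : Fin d → ℝ, (∀ i, 0 ≤ c i) ∧ y = ∑ i, c i • (S.vertex i : EuclideanSpace ℝ (Fin d))}

theorem isClosed_cone (S : SphericalSimplex d) : IsClosed S.cone := by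
  obtain hd | hd := isEmpty_or_nonempty (Fin d)
  · exact (subsingleton_of_subsingleton).isClosed
  let b := basisOfLinearIndependentOfCardEqFinrank S.linearIndependent (by simp)
  have hb : ∀ i, b i = S.vertex i := fun i => by simp [b]
  have : S.cone = ⋂ i, {y | 0 ≤ b.equivFun y i} := by
    ext y
    simp only [mem_iInter, mem_ofPred]
    constructor
    · rintro ⟨c, hc, rfl⟩ i
      have h : ∑ i, c i • (S.vertex i : EuclideanSpace ℝ (Fin d)) = b.equivFun.symm c := by
        simp [Basis.equivFun_symm_apply, hb]
      rw [h, LinearEquiv.apply_symm_apply]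
      exact hc i
    · intro h
      exact ⟨b.equivFun y, h, by simpa [hb] using (b.sum_equivFun y).symm⟩
  rw [this]
  refine isClosed_iInter fun i => isClosed_le continuous_const ?_
  exact (continuous_apply i).comp
    (LinearMap.continuous_of_finiteDimensional b.equivFun.toLinearMap)

theorem smul_mem_cone {y : EuclideanSpace ℝ (Fin d)} (hy : y ∈ S.cone) {t : ℝ} (ht : 0 ≤ t) :
    t • y ∈ S.cone := by
  obtain ⟨c, hc, rfl⟩ := hy
  exact ⟨fun i => t * c i, fun i => mul_nonneg ht (hc i), by simp [Finset.smul_sum, smul_smul]⟩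

theorem add_mem_cone {y z : EuclideanSpace ℝ (Fin d)} (hy : y ∈ S.cone) (hz : z ∈ S.cone) :
    y + z ∈ S.cone := by
  obtain ⟨c, hc, rfl⟩ := hy
  obtain ⟨e, he, rfl⟩ := hz
  exact ⟨fun i => c i + e i, fun i => add_nonneg (hc i) (he i), by
    simp [add_smul, Finset.sum_add_distrib]⟩

/-- `Measure.toSphere` measures a set through the open cone `Ioo 0 1 • _`, which omits the apex;
hence the removal of `0`. -/
theorem Ioo_smul_image_toSet (S : SphericalSimplex d) :
    Ioo (0 : ℝ) 1 • ((↑) '' S.toSet : Set (EuclideanSpace ℝ (Fin d))) =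
      S.cone ∩ (ball 0 1 ∩ {0}ᶜ) := by
  ext y
  rw [Set.mem_smul]
  constructor
  · rintro ⟨t, ht, _, ⟨z, hz, rfl⟩, rfl⟩
    have hz1 : ‖(z : EuclideanSpace ℝ (Fin d))‖ = 1 := by simp
    refine ⟨smul_mem_cone hz ht.1.le, ?_, ?_⟩
    · rw [mem_ball_zero_iff, norm_smul, hz1, mul_one, Real.norm_of_nonneg ht.1.le]
      exact ht.2
    · rw [mem_compl_iff, mem_singleton_iff, ← norm_eq_zero, norm_smul, hz1, mul_one, norm_eq_zero]
      exact ht.1.ne'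
  · rintro ⟨hy, hy1, hy0⟩
    have hn : 0 < ‖y‖ := norm_pos_iff.2 hy0
    refine ⟨‖y‖, ⟨hn, by simpa using hy1⟩, ‖y‖⁻¹ • y, ?_, smul_inv_smul₀ hn.ne' y⟩
    refine ⟨⟨‖y‖⁻¹ • y, ?_⟩, smul_mem_cone hy (by positivity), rfl⟩
    rw [mem_sphere_zero_iff_norm, norm_smul, norm_inv, norm_norm, inv_mul_cancel₀ hn.ne']

theorem vol_eq_volume_cone (S : SphericalSimplex d) :
    S.vol = d * volume (S.cone ∩ (ball 0 1 ∩ {0}ᶜ)) := by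
  have hm : MeasurableSet S.toSet :=
    (S.isClosed_cone.preimage continuous_subtype_val).measurableSet
  rw [vol, Measure.toSphere_apply' _ hm, Ioo_smul_image_toSet]
  simp

/-- The points `p i` are the central projections of the vertices of `S` to the hyperplane tangent
to the sphere at `x`, and the `h i` are the heights of the vertices. -/
def IsGnomonicProjection (S : SphericalSimplex d) (x : UnitSphere d) (h : Fin d → ℝ)
    (p : Fin d → (ℝ ∙ (x : EuclideanSpace ℝ (Fin d)))ᗮ) : Prop :=
  ∀ i, 0 < h i ∧ (S.vertex i : EuclideanSpace ℝ (Fin d)) =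
    h i • ((x : EuclideanSpace ℝ (Fin d)) + (p i : EuclideanSpace ℝ (Fin d)))

theorem exists_isGnomonicProjection (hS : ∀ i, 0 < ⟪(x : EuclideanSpace ℝ (Fin d)),
    (S.vertex i : EuclideanSpace ℝ (Fin d))⟫) : ∃ h p, S.IsGnomonicProjection x h p := by
  have hx : ‖(x : EuclideanSpace ℝ (Fin d))‖ = 1 := by simp
  refine ⟨fun i => ⟪(x : EuclideanSpace ℝ (Fin d)), (S.vertex i : EuclideanSpace ℝ (Fin d))⟫,
    fun i => ⟨(⟪(x : EuclideanSpace ℝ (Fin d)), (S.vertex i : EuclideanSpace ℝ (Fin d))⟫)⁻¹ •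
      (S.vertex i : EuclideanSpace ℝ (Fin d)) - x, ?_⟩, fun i => ⟨hS i, ?_⟩⟩
  · rw [Submodule.mem_orthogonal_singleton_iff_inner_right, inner_sub_right, real_inner_smul_right,
      inv_mul_cancel₀ (hS i).ne', real_inner_self_eq_norm_sq, hx]
    norm_num
  · rw [add_sub_cancel, smul_inv_smul₀ (hS i).ne']

/-- The `x`-component of a linear relation among the `x + p i` says that its coefficients sum to
`0`, so it is an affine relation among the `p i`. The positive factors `h i` only rescale
coefficients. -/
theorem linearIndependent_smul_add_iff {ι E : Type*} [Fintype ι] [NormedAddCommGroup E]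
    [InnerProductSpace ℝ E] {x : E} (hx : ‖x‖ = 1) {h : ι → ℝ} (hh : ∀ i, 0 < h i)
    (p : ι → (ℝ ∙ x)ᗮ) :
    LinearIndependent ℝ (fun i => h i • (x + (p i : E))) ↔ AffineIndependent ℝ p := by
  have hsum : ∀ g : ι → ℝ, ∑ i, g i • (x + (p i : E)) =
      (∑ i, g i) • x + ((∑ i, g i • p i : (ℝ ∙ x)ᗮ) : E) := fun g => by
    simp [smul_add, Finset.sum_add_distrib, Finset.sum_smul]
  have hzero : ∀ g : ι → ℝ, ∑ i, g i • (x + (p i : E)) = 0 ↔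
      ∑ i, g i = 0 ∧ ∑ i, g i • p i = 0 := fun g => by
    rw [hsum]
    refine ⟨fun h0 => ?_, fun ⟨h1, h2⟩ => by rw [h1, h2]; simp⟩
    have h1 : ∑ i, g i = 0 := by
      rw [← inner_add_smul_of_mem_orthogonal hx (∑ i, g i) (∑ i, g i • p i), h0, inner_zero_right]
    refine ⟨h1, ?_⟩
    rwa [h1, zero_smul, zero_add, Submodule.coe_eq_zero] at h0
  rw [Fintype.linearIndependent_iff, affineIndependent_iff_of_fintype]
  constructor
  · intro H w hw hw0 i
    rw [Finset.univ.weightedVSub_eq_linear_combination hw] at hw0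
    have := H (fun i => w i / h i) (by
      rw [← (hzero w).2 ⟨hw, hw0⟩]
      refine Finset.sum_congr rfl fun i _ => ?_
      rw [smul_smul, div_mul_cancel₀ _ (hh i).ne']) i
    exact (div_eq_zero_iff.1 this).resolve_right (hh i).ne'
  · intro H g hg i
    simp only [smul_smul] at hg
    have h0 := (hzero fun i => g i * h i).1 hg
    have := H (fun i => g i * h i) h0.1 (by
      rw [Finset.univ.weightedVSub_eq_linear_combination h0.1]
      exact h0.2) i
    exact (mul_eq_zero.1 this).resolve_right (hh i).ne'

namespace IsGnomonicProjection

variable {h : Fin d → ℝ} {p : Fin d → (ℝ ∙ (x : EuclideanSpace ℝ (Fin d)))ᗮ}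

theorem affineIndependent (hp : S.IsGnomonicProjection x h p) : AffineIndependent ℝ p := by
  refine (linearIndependent_smul_add_iff (by simp) (fun i => (hp i).1) p).1 ?_
  have := S.linearIndependent
  rwa [show (fun i => (S.vertex i : EuclideanSpace ℝ (Fin d))) = fun i => h i •
    ((x : EuclideanSpace ℝ (Fin d)) + (p i : EuclideanSpace ℝ (Fin d))) from
    funext fun i => (hp i).2] at this

theorem inner_vertex_vertex (hp : S.IsGnomonicProjection x h p) (i j : Fin d) :
    ⟪(S.vertex i : EuclideanSpace ℝ (Fin d)), (S.vertex j : EuclideanSpace ℝ (Fin d))⟫ =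
      h i * h j * (1 + ⟪p i, p j⟫) := by
  have := inner_smul_add_smul_add (x := (x : EuclideanSpace ℝ (Fin d))) (by simp) 1 1 (p i) (p j)
  rw [one_smul, one_mul] at this
  rw [(hp i).2, (hp j).2, real_inner_smul_left, real_inner_smul_right, this]
  ring

theorem inner_vertex (hp : S.IsGnomonicProjection x h p) (i : Fin d) :
    ⟪(x : EuclideanSpace ℝ (Fin d)), (S.vertex i : EuclideanSpace ℝ (Fin d))⟫ = h i := by
  have := inner_add_smul_of_mem_orthogonal (x := (x : EuclideanSpace ℝ (Fin d))) (by simp) 1 (p i)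
  rw [one_smul] at this
  rw [(hp i).2, real_inner_smul_right, this, mul_one]

theorem sq_mul_eq_one (hp : S.IsGnomonicProjection x h p) (i : Fin d) :
    h i ^ 2 * (1 + ‖p i‖ ^ 2) = 1 := by
  have h1 := hp.inner_vertex_vertex i i
  rw [real_inner_self_eq_norm_sq, real_inner_self_eq_norm_sq] at h1
  have h2 : ‖(S.vertex i : EuclideanSpace ℝ (Fin d))‖ = 1 := by simp
  rw [h2] at h1
  linarith

theorem norm_sq_eq (hp : S.IsGnomonicProjection x h p) (i : Fin d) :
    ‖p i‖ ^ 2 = (h i ^ 2)⁻¹ - 1 := by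
  have := hp.sq_mul_eq_one i
  have h0 := (hp i).1
  field_simp
  linarith

/-- Height `cos α` corresponds to `‖p i‖ ^ 2 = 1 / cos² α - 1 = tan² α`, so the cap projects to the
ball of radius `tan α`. -/
theorem norm_le_tan (hp : S.IsGnomonicProjection x h p) (hα0 : 0 < α) (hα : α < Real.pi / 2)
    {i : Fin d} (hi : Real.cos α ≤ h i) : ‖p i‖ ≤ Real.tan α := by
  have hc : 0 < Real.cos α := Real.cos_pos_of_mem_Ioo ⟨by linarith, hα⟩
  have ht : 0 < Real.tan α := Real.tan_pos_of_pos_of_lt_pi_div_two hα0 hα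
  rw [← sq_le_sq₀ (norm_nonneg _) ht.le, hp.norm_sq_eq]
  have h1 : (h i ^ 2)⁻¹ ≤ (Real.cos α ^ 2)⁻¹ := by gcongr
  have h2 := Real.inv_one_add_tan_sq hc.ne'
  rw [← h2, inv_inv] at h1
  linarith

theorem norm_eq_tan_iff (hp : S.IsGnomonicProjection x h p) (hα0 : 0 < α)
    (hα : α < Real.pi / 2) {i : Fin d} : ‖p i‖ = Real.tan α ↔ h i = Real.cos α := by
  have hc : 0 < Real.cos α := Real.cos_pos_of_mem_Ioo ⟨by linarith, hα⟩
  have ht : 0 < Real.tan α := Real.tan_pos_of_pos_of_lt_pi_div_two hα0 hα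
  have h2 := Real.inv_one_add_tan_sq hc.ne'
  rw [← sq_eq_sq₀ (norm_nonneg _) ht.le, hp.norm_sq_eq, ← sq_eq_sq₀ (hp i).1.le hc.le, ← h2,
    ← inv_inj (a := h i ^ 2), inv_inv]
  constructor <;> intro h <;> linarith

/-- Once all heights equal `cos α`, the vertices have inner products `cos² α (1 + ⟪p i, p j⟫)`, so
the two Gram matrices determine each other. -/
theorem isRegularInscribedInCap_iff (hp : S.IsGnomonicProjection x h p) (hα0 : 0 < α)
    (hα : α < Real.pi / 2) :
    S.IsRegularInscribedInCap x α ↔ IsRegularFrame (Real.tan α) p := by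
  have hc : 0 < Real.cos α := Real.cos_pos_of_mem_Ioo ⟨by linarith, hα⟩
  unfold IsRegularInscribedInCap IsRegularFrame
  simp only [hp.norm_eq_tan_iff hα0 hα, hp.inner_vertex]
  rw [and_comm]
  refine and_congr_right fun hh => ?_
  have hin := hp.inner_vertex_vertex
  simp only [hh] at hin
  constructor
  · intro hreg
    by_cases hex : ∃ a b : Fin d, a ≠ b
    · obtain ⟨a, b, hab⟩ := hex
      refine ⟨⟪p a, p b⟫, fun i j hij => ?_⟩
      -- Some permutation takes `(i, j)` to the fixed pair `(a, b)`, and its isometry identifies the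
      -- two inner products.
      obtain ⟨σ, hσi, hσj⟩ := MulAction.is_two_pretransitive_iff.1
        (Equiv.Perm.isMultiplyPretransitive (Fin d) 2) hij hab
      obtain ⟨g, hg⟩ := hreg σ
      have h1 := g.inner_map_map (S.vertex i : EuclideanSpace ℝ (Fin d)) (S.vertex j)
      rw [hg, hg, show σ i = a from hσi, show σ j = b from hσj, hin, hin] at h1
      have := mul_left_cancel₀ (mul_pos hc hc).ne' h1
      linarith
    · push Not at hex
      exact ⟨0, fun i j hij => absurd (hex i j) hij⟩
  · rintro ⟨c, hcc⟩ σ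
    refine exists_linearIsometryEquiv_of_inner_eq
      (w := fun i => (S.vertex (σ i) : EuclideanSpace ℝ (Fin d))) ?_ fun i j => ?_
    · exact S.linearIndependent.span_eq_top_of_card_eq_finrank' (by simp)
    · obtain rfl | hij := eq_or_ne i j
      · simp
      · rw [hin, hin, hcc i j hij, hcc _ _ (σ.injective.ne hij)]

/-- For a cone point `∑ c i • v i` the height `a` is `∑ c i * h i`, and dividing by it turns the
numbers `c i * h i` into convex weights of the `p i`. This is the description of the cone that
`volume_cone_eq_radialMeasure` needs. -/
theorem smul_add_mem_iff (hp : S.IsGnomonicProjection x h p) (a : ℝ)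
    (q : (ℝ ∙ (x : EuclideanSpace ℝ (Fin d)))ᗮ) :
    a • (x : EuclideanSpace ℝ (Fin d)) + (q : EuclideanSpace ℝ (Fin d)) ∈
      S.cone ∩ (ball 0 1 ∩ {0}ᶜ) ↔ 0 < a ∧ a⁻¹ • q ∈ convexHull ℝ (range p) ∧
        ‖a • (x : EuclideanSpace ℝ (Fin d)) + (q : EuclideanSpace ℝ (Fin d))‖ < 1 := by
  have hx : ‖(x : EuclideanSpace ℝ (Fin d))‖ = 1 := by simp
  have hsum : ∀ c : Fin d → ℝ, ∑ i, c i • (S.vertex i : EuclideanSpace ℝ (Fin d)) =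
      (∑ i, c i * h i) • (x : EuclideanSpace ℝ (Fin d)) +
        ((∑ i, (c i * h i) • p i : (ℝ ∙ (x : EuclideanSpace ℝ (Fin d)))ᗮ) :
          EuclideanSpace ℝ (Fin d)) := fun c => by
    rw [Finset.sum_smul, Submodule.coe_sum, ← Finset.sum_add_distrib]
    refine Finset.sum_congr rfl fun i _ => ?_
    rw [(hp i).2, smul_smul, smul_add, Submodule.coe_smul]
  simp only [mem_inter_iff, mem_ball_zero_iff, mem_compl_iff, mem_singleton_iff]
  constructor
  · rintro ⟨⟨c, hc, hy⟩, hlt, hne⟩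
    have ha : a = ∑ i, c i * h i := by
      have h1 := congrArg (fun y => ⟪(x : EuclideanSpace ℝ (Fin d)), y⟫) (hy.trans (hsum c))
      simpa only [inner_add_smul_of_mem_orthogonal hx] using h1
    have hq : q = ∑ i, (c i * h i) • p i := by
      rw [hsum, ← ha, add_right_inj] at hy
      exact Subtype.ext hy
    have hc0 : ∀ i, 0 ≤ c i * h i := fun i => mul_nonneg (hc i) (hp i).1.le
    have ha0 : 0 < a := by
      refine lt_of_le_of_ne (ha ▸ Finset.sum_nonneg fun i _ => hc0 i) fun h0 => hne ?_
      have hz : ∀ i, c i = 0 := fun i => by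
        have := (Finset.sum_eq_zero_iff_of_nonneg fun i _ => hc0 i).1 (ha ▸ h0.symm) i
          (Finset.mem_univ i)
        exact (mul_eq_zero.1 this).resolve_right (hp i).1.ne'
      rw [hy]
      simp [hz]
    refine ⟨ha0, ?_, hlt⟩
    rw [hq, Finset.smul_sum]
    simp only [smul_smul]
    refine (convex_convexHull ℝ _).sum_mem (fun i _ => mul_nonneg (inv_nonneg.2 ha0.le) (hc0 i)) ?_
      fun i _ => subset_convexHull ℝ _ ⟨i, rfl⟩
    rw [← Finset.mul_sum, ← ha, inv_mul_cancel₀ ha0.ne']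
  · rintro ⟨ha0, hq, hlt⟩
    refine ⟨?_, hlt, fun h0 => ha0.ne' ?_⟩
    · have hsub : convexHull ℝ (range p) ⊆ {q | (x : EuclideanSpace ℝ (Fin d)) + q ∈ S.cone} := by
        refine convexHull_min ?_ fun q₁ h₁ q₂ h₂ s t hs ht hst => ?_
        · rintro _ ⟨i, rfl⟩
          refine ⟨Pi.single i (h i)⁻¹, fun j => ?_, ?_⟩
          · rw [Pi.single_apply]
            split_ifs
            exacts [inv_nonneg.2 (hp i).1.le, le_rfl]
          · simp [Pi.single_apply, (hp i).2, (hp i).1.ne']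
        · rw [mem_ofPred] at h₁ h₂ ⊢
          convert! add_mem_cone (smul_mem_cone h₁ hs) (smul_mem_cone h₂ ht) using 1
          rw [smul_add, smul_add, add_add_add_comm, ← add_smul, hst, one_smul]
          rfl
      convert! smul_mem_cone (hsub hq) ha0.le using 1
      rw [smul_add, Submodule.coe_smul, smul_inv_smul₀ ha0.ne']
    · rw [← inner_add_smul_of_mem_orthogonal hx a q, h0, inner_zero_right]

theorem vol_eq (hp : S.IsGnomonicProjection x h p) :
    S.vol = d * radialMeasure (ℝ ∙ (x : EuclideanSpace ℝ (Fin d)))ᗮ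
      (gnomonicProfile (finrank ℝ (ℝ ∙ (x : EuclideanSpace ℝ (Fin d)))ᗮ))
      (convexHull ℝ (range p)) := by
  rw [vol_eq_volume_cone, volume_cone_eq_radialMeasure (by simp)
    ((finite_range p).isCompact_convexHull ℝ).measurableSet _ hp.smul_add_mem_iff]
  exact S.isClosed_cone.measurableSet.inter
    (measurableSet_ball.inter (measurableSet_singleton _).compl)

end IsGnomonicProjection

/-- For a unit vector `∑ c i • v i` with `c i ≥ 0` the triangle inequality gives `∑ c i ≥ 1`, and
since `cos α > 0` the bound at the vertices passes to it. -/
theorem toSet_subset_sphericalCap_iff (hα0 : 0 < α) (hα : α < Real.pi / 2) :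
    S.toSet ⊆ sphericalCap x α ↔ ∀ i, Real.cos α ≤ ⟪(x : EuclideanSpace ℝ (Fin d)),
      (S.vertex i : EuclideanSpace ℝ (Fin d))⟫ := by
  have hc : 0 < Real.cos α := Real.cos_pos_of_mem_Ioo ⟨by linarith, hα⟩
  constructor
  · intro h i
    refine h (a := S.vertex i) ⟨Pi.single i 1, fun j => ?_, by simp [Pi.single_apply]⟩
    rw [Pi.single_apply]
    split_ifs
    exacts [zero_le_one, le_rfl]
  · rintro h y ⟨c, hc0, hy⟩
    have hsum : 1 ≤ ∑ i, c i := by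
      have h1 : ‖(y : EuclideanSpace ℝ (Fin d))‖ = 1 := by simp
      rw [← h1, hy]
      refine (norm_sum_le _ _).trans (Finset.sum_le_sum fun i _ => ?_)
      rw [norm_smul, Real.norm_of_nonneg (hc0 i)]
      simp
    change Real.cos α ≤ ⟪(x : EuclideanSpace ℝ (Fin d)), (y : EuclideanSpace ℝ (Fin d))⟫
    rw [hy, inner_sum]
    calc Real.cos α ≤ (∑ i, c i) * Real.cos α := le_mul_of_one_le_left hc.le hsum
      _ = ∑ i, c i * Real.cos α := Finset.sum_mul _ _ _
      _ ≤ _ := Finset.sum_le_sum fun i _ => by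
        rw [real_inner_smul_right]
        exact mul_le_mul_of_nonneg_left (h i) (hc0 i)

theorem finrank_orthogonal_add_one (x : UnitSphere d) :
    finrank ℝ (ℝ ∙ (x : EuclideanSpace ℝ (Fin d)))ᗮ + 1 = d := by
  have hx : (x : EuclideanSpace ℝ (Fin d)) ≠ 0 := ne_zero_of_mem_unit_sphere x
  have := Submodule.finrank_add_finrank_orthogonal (ℝ ∙ (x : EuclideanSpace ℝ (Fin d)))
  rw [finrank_span_singleton hx, finrank_euclideanSpace_fin] at this
  omega

theorem nontrivial_orthogonal (hd : 2 ≤ d) (x : UnitSphere d) :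
    Nontrivial (ℝ ∙ (x : EuclideanSpace ℝ (Fin d)))ᗮ := by
  have := finrank_orthogonal_add_one x
  exact nontrivial_of_finrank_pos (R := ℝ) (by omega)

theorem exists_isRegularInscribedInCap (hd : 2 ≤ d) (x : UnitSphere d) (hα0 : 0 < α)
    (hα : α < Real.pi / 2) : ∃ T : SphericalSimplex d, T.IsRegularInscribedInCap x α := by
  have hc : 0 < Real.cos α := Real.cos_pos_of_mem_Ioo ⟨by linarith, hα⟩
  have hx : ‖(x : EuclideanSpace ℝ (Fin d))‖ = 1 := by simp
  have := nontrivial_orthogonal hd x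
  obtain ⟨p, hpa, hp⟩ := exists_isRegularFrame (V := (ℝ ∙ (x : EuclideanSpace ℝ (Fin d)))ᗮ)
    (ι := Fin d) (Real.tan_pos_of_pos_of_lt_pi_div_two hα0 hα)
    (by rw [finrank_orthogonal_add_one, Fintype.card_fin])
  -- The frame of radius `tan α` is lifted back to height `cos α`; the norm is `1` because `1 + tan²
  -- α = 1 / cos² α`.
  have hv : ∀ i, Real.cos α • ((x : EuclideanSpace ℝ (Fin d)) + (p i : EuclideanSpace ℝ (Fin d))) ∈
      sphere (0 : EuclideanSpace ℝ (Fin d)) 1 := fun i => by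
    have h1 := norm_sq_smul_add hx 1 (p i)
    rw [one_smul, hp.1, one_pow] at h1
    rw [mem_sphere_zero_iff_norm, ← sq_eq_sq₀ (norm_nonneg _) zero_le_one, norm_smul, mul_pow, h1,
      Real.norm_of_nonneg hc.le, ← Real.inv_one_add_tan_sq hc.ne']
    field_simp
  let T : SphericalSimplex d := ⟨fun i => ⟨_, hv i⟩,
    (linearIndependent_smul_add_iff hx (fun _ => hc) p).2 hpa⟩
  have hT : T.IsGnomonicProjection x (fun _ => Real.cos α) p := fun i => ⟨hc, rfl⟩
  exact ⟨T, (hT.isRegularInscribedInCap_iff hα0 hα).2 hp⟩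

theorem vol_le_and_eq_iff (hd : 2 ≤ d) (hα0 : 0 < α) (hα : α < Real.pi / 2)
    {T : SphericalSimplex d} (hT : T.IsRegularInscribedInCap x α)
    (hS : S.toSet ⊆ sphericalCap x α) :
    S.vol ≤ T.vol ∧ (S.vol = T.vol ↔ S.IsRegularInscribedInCap x α) := by
  have hc : 0 < Real.cos α := Real.cos_pos_of_mem_Ioo ⟨by linarith, hα⟩
  have := nontrivial_orthogonal hd x
  have hSv := (toSet_subset_sphericalCap_iff hα0 hα).1 hS
  obtain ⟨h, p, hp⟩ := S.exists_isGnomonicProjection fun i => hc.trans_le (hSv i)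
  obtain ⟨k, q, hq⟩ := T.exists_isGnomonicProjection fun i => hc.trans_le (hT.2 i).ge
  have key := radialMeasure_convexHull_le_and_eq_iff (antitone_gnomonicProfile
    (finrank ℝ (ℝ ∙ (x : EuclideanSpace ℝ (Fin d)))ᗮ)) (gnomonicProfile_ne_top _ 0)
    (Real.tan_pos_of_pos_of_lt_pi_div_two hα0 hα)
    ((strictAntiOn_gnomonicProfile _).mono Icc_subset_Ici_self)
    (by rw [finrank_orthogonal_add_one, Fintype.card_fin]) hq.affineIndependent
    ((hq.isRegularInscribedInCap_iff hα0 hα).1 hT) hp.affineIndependent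
    fun i => hp.norm_le_tan hα0 hα (by rw [← hp.inner_vertex]; exact hSv i)
  rw [hp.isRegularInscribedInCap_iff hα0 hα, hp.vol_eq, hq.vol_eq, ← key.2]
  have hd0 : (d : ℝ≥0∞) ≠ 0 := by
    have : d ≠ 0 := by omega
    exact_mod_cast this
  exact ⟨mul_le_mul_right key.1 _, ENNReal.mul_right_inj hd0 (ENNReal.natCast_ne_top d)⟩

end SphericalSimplex

theorem mainTheorem8 :
    -- among simplices in a ball, exactly the regular inscribed ones maximize the weighted integral
    (∀ (d : ℕ), 1 ≤ d → ∀ (r : ℝ), 0 < r →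
      ∀ (μ : EuclideanSpace ℝ (Fin d) → ℝ), IsRadialStrictAntiWeight r μ →
        IntegrableOn μ (Metric.closedBall 0 r) ∧
        ∀ (T : Affine.Simplex ℝ (EuclideanSpace ℝ (Fin d)) d), IsRegularInscribedInBall r T →
        ∀ (S : Affine.Simplex ℝ (EuclideanSpace ℝ (Fin d)) d),
          S.closedInterior ⊆ Metric.closedBall 0 r →
          (∫ p in S.closedInterior, μ p) ≤ (∫ p in T.closedInterior, μ p) ∧
          ((∫ p in S.closedInterior, μ p) = (∫ p in T.closedInterior, μ p) ↔
            IsRegularInscribedInBall r S)) ∧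
    -- among spherical simplices in a cap, exactly the regular inscribed ones have maximum volume
    (∀ (d : ℕ), 2 ≤ d → ∀ (x : UnitSphere d) (α : ℝ), 0 < α → α < Real.pi / 2 →
      (∃ T : SphericalSimplex d, T.IsRegularInscribedInCap x α) ∧
      ∀ (T : SphericalSimplex d), T.IsRegularInscribedInCap x α →
        T.toSet ⊆ sphericalCap x α ∧
        ∀ (S : SphericalSimplex d), S.toSet ⊆ sphericalCap x α →
          S.vol ≤ T.vol ∧ (S.vol = T.vol ↔ S.IsRegularInscribedInCap x α)) := by
  refine ⟨fun d hd r hr μ hμ => ⟨?_, fun T hT S hS =>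
    setIntegral_simplex_le_and_eq_iff hd hr hμ T hT S hS⟩, fun d hd x α hα0 hα =>
    ⟨SphericalSimplex.exists_isRegularInscribedInCap hd x hα0 hα, fun T hT =>
    ⟨(SphericalSimplex.toSet_subset_sphericalCap_iff hα0 hα).2 fun i => (hT.2 i).ge,
    fun S hS => SphericalSimplex.vol_le_and_eq_iff hd hα0 hα hT hS⟩⟩⟩
  have : Nonempty (Fin d) := ⟨⟨0, hd⟩⟩
  obtain ⟨e, he⟩ := exists_norm_eq (EuclideanSpace ℝ (Fin d)) (zero_le_one' ℝ)
  exact hμ.integrableOn hr he
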